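/- **Theorem (convergence of the inexact proximal point algorithm for the rank lasso).** Let $A:\mathbb R^p\to\mathbb R^n$ be linear, $b\in\mathbb R^n$, $\lambda>0$. For a convex function $h:\mathbb R^n\to\mathbb R$ consider $$\min_{x\in\mathbb R^p} f(x):=h(b-Ax)+\lambda\|x\|_1, \tag{P}$$ and let $0<\sigma_0\le\sigma_1\le\cdots$ with $\sigma_k\uparrow\sigma_\infty\in(0,+\infty]$. Put $P_k(y)=\arg\min_x\{f(x)+\frac1{2\sigma_k}\|x-y\|^2\}$, $$\mathcal T(x,u,\alpha)=\{(-A^\top\alpha+t,\;v-\alpha,\;-u+b-Ax)\;:\;t\in\lambda\,\partial\|x\|_1,\ v\in\partial h(u)\},$$ $$S_k(x,u,\alpha)=\mathcal T(x,u,\alpha)+\tfrac1{\sigma_k}(x-x^k,0,0).$$ For a sequence $\{x^k\}\subset\mathbb R^p$ consider the following criteria, each required for all $k\ge0$; in (A′) and (B′) the inequality is required for some vectors $u^{k+1},\alpha^{k+1}\in\mathbb R^n$. * (A) $\|x^{k+1}-P_k(x^k)\|\le\varepsilon_k$, for some $\varepsilon_k\ge0$ with $\sum_k\varepsilon_k<\infty$;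 * (A′) $\mathrm{dist}(0,S_k(x^{k+1},u^{k+1},\alpha^{k+1}))\le\gamma_k/\sigma_k$, for some $\gamma_k\ge0$ with $\sum_k\gamma_k<\infty$; * (B) $\|x^{k+1}-P_k(x^k)\|\le\delta_k\|x^{k+1}-x^k\|$, where $\delta_k\ge0$, $\sum_k\delta_k<\infty$; * (B′) $\mathrm{dist}(0,S_k(x^{k+1},u^{k+1},\alpha^{k+1}))\le(\delta_k/\sigma_k)\|x^{k+1}-x^k\|$, where $\delta_k\ge0$, $\sum_k\delta_k<\infty$. Call $\kappa\ge0$ an *error bound modulus* if there is $\epsilon'>0$ such that $\mathrm{dist}(z,\mathcal T^{-1}(0))\le\kappa\,\mathrm{dist}(0,\mathcal T(z))$ for all $z=(x,u,\alpha)$ with $\mathrm{dist}(0,\mathcal T(z))<\epsilon'$. For such $\kappa$ and for $c\ge1$ put $$\mu_k=\frac{\kappa}{(\kappa^2+\sigma_k^2)^{1/2}},\qquad \mu_\infty=\frac{\kappa}{(\kappa^2+\sigma_\infty^2)^{1/2}}\ \ (\mu_\infty=0\text{ if }\sigma_\infty=\infty),\qquad \theta_k^{(c)}=\frac{\mu_k+c\,\delta_k}{1-\delta_k},$$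 and write $R(c)$ for the assertion: $\theta^{(c)}_k\to\mu_\infty$, and there is $\bar k$ such that for all $k\ge\bar k$, $\theta_k^{(c)}<1$ and $\|x^{k+1}-\bar x\|\le\theta^{(c)}_k\|x^k-\bar x\|$. Suppose that (P) has a solution and that $\{x^k\}$ satisfies (A) or (A′). Then $\{x^k\}$ converges to a solution $\bar x$ of (P). Moreover: 1. If $h$ is polyhedral (a maximum of finitely many affine functions), then an error bound modulus exists, and for every error bound modulus $\kappa$: if (B′) also holds, then $R(1)$; if (B) also holds and $\sigma_\infty<\infty$, then $R(1)$; if (B) also holds (with $\sigma_\infty\le\infty$ arbitrary), then $R(c)$ for every $c>1$. 2. For arbitrary convex $h$: if (P) has exactly one solution, $\kappa$ is an error bound modulus and (B) also holds, then $R(1)$. Finally, the rank lasso loss $h(u)=\frac{2}{n(n-1)}\sum_{1\le i<j\le n}|u_i-u_j|$ (read as $0$ if $n\le1$) is polyhedral, and with it (P) always has a solution. -/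

import Mathlib

open Filter Topology Set
open scoped RealInnerProductSpace

noncomputable section

namespace HdrLasso

/-- Euclidean space `ℝ^d`. -/
abbrev Vec (d : ℕ) : Type := EuclideanSpace ℝ (Fin d)

/-- The space `ℝ^p × ℝ^n × ℝ^n` of triples `(x, u, α)`, with the Euclidean norm. -/
abbrev Triple (p n : ℕ) : Type := WithLp 2 (Vec p × WithLp 2 (Vec n × Vec n))

/-- The triple `(x, u, α)` as a point of the Euclidean space `ℝ^p × ℝ^n × ℝ^n`. -/
def triple {p n : ℕ} (x : Vec p) (u α : Vec n) : Triple p n :=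
  WithLp.toLp 2 (x, WithLp.toLp 2 (u, α))

/-- The norm `‖x‖₁`. -/
def l1 {d : ℕ} (x : Vec d) : ℝ := ∑ i, |x i|

/-- The convex subdifferential `∂f(x)`. -/
def subdiff {d : ℕ} (f : Vec d → ℝ) (x : Vec d) : Set (Vec d) :=
  {g | ∀ y, f x + ⟪g, y - x⟫ ≤ f y}

/-- The set of global minimizers of `f`. -/
def argmin {d : ℕ} (f : Vec d → ℝ) : Set (Vec d) := {x | ∀ y, f x ≤ f y}

/-- `h` is polyhedral (piecewise linear convex): the maximum of finitely many (at least one)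
affine functions. -/
def IsPolyhedral {d : ℕ} (h : Vec d → ℝ) : Prop :=
  ∃ (m : ℕ) (a : Fin (m + 1) → Vec d) (c : Fin (m + 1) → ℝ),
    ∀ u, h u = ⨆ i, (⟪a i, u⟫ + c i)

/-- The rank loss `h(u) = 2 / (n (n - 1)) * ∑_{i < j} |u_i - u_j|` of the high-dimensional
rank lasso. -/
def rankLoss (n : ℕ) (u : Vec n) : ℝ :=
  2 / ((n : ℝ) * ((n : ℝ) - 1)) * ∑ i, ∑ j ∈ Finset.univ.filter (fun j => i < j), |u i - u j|

section Problem

variable {p n : ℕ} (h : Vec n → ℝ) (A : Vec p →L[ℝ] Vec n) (b : Vec n) (lam : ℝ)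

/-- The objective `h(b - Ax) + λ‖x‖₁`. -/
def objective (x : Vec p) : ℝ := h (b - A x) + lam * l1 x

/-- The solution set of `min_x h(b - Ax) + λ‖x‖₁`. -/
def solutions : Set (Vec p) := argmin (objective h A b lam)

/-- The proximal point map `P(y) = argmin_x h(b - Ax) + λ‖x‖₁ + ‖x - y‖² / (2s)`,
as the set of minimizers. -/
def proxPoint (s : ℝ) (y : Vec p) : Set (Vec p) :=
  argmin (fun x => objective h A b lam x + 1 / (2 * s) * ‖x - y‖ ^ 2)

/-- The KKT operator
`T(x,u,α) = {(-Aᵀα + t, v - α, -u + b - Ax) | t ∈ λ ∂‖x‖₁, v ∈ ∂h(u)}`. -/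
def kkt (z : Triple p n) : Set (Triple p n) :=
  {w | ∃ g ∈ subdiff l1 z.fst, ∃ v ∈ subdiff h z.snd.fst,
    w = triple (-(ContinuousLinearMap.adjoint A z.snd.snd) + lam • g) (v - z.snd.snd)
      (-z.snd.fst + b - A z.fst)}

/-- `S(x,u,α) = T(x,u,α) + (1/s) (x - y, 0, 0)`. -/
def proxKkt (s : ℝ) (y : Vec p) (z : Triple p n) : Set (Triple p n) :=
  {w | ∃ w' ∈ kkt h A b lam z, w = w' + (1 / s) • triple (z.fst - y) 0 0}

/-- `κ ≥ 0` is a modulus of the error bound of `T` at the origin: for some `ε > 0`,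
`dist(z, T⁻¹(0)) ≤ κ dist(0, T(z))` for all `z` with `dist(0, T(z)) < ε`. -/
def IsErrorBoundModulus (κ : ℝ) : Prop :=
  0 ≤ κ ∧ ∃ ε > 0, ∀ z : Triple p n, Metric.infDist 0 (kkt h A b lam z) < ε →
    Metric.infDist z {z' | 0 ∈ kkt h A b lam z'} ≤ κ * Metric.infDist 0 (kkt h A b lam z)

/-- Criterion (A): `‖x^{k+1} - P_k(x^k)‖ ≤ ε_k`, `ε_k ≥ 0`, `∑ ε_k < ∞`. -/
def CritA (σ : ℕ → ℝ) (x : ℕ → Vec p) : Prop :=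
  ∃ ε : ℕ → ℝ, (∀ k, 0 ≤ ε k) ∧ Summable ε ∧
    ∀ k, ∃ y ∈ proxPoint h A b lam (σ k) (x k), ‖x (k + 1) - y‖ ≤ ε k

/-- Criterion (A'): `dist(0, S_k(x^{k+1}, u^{k+1}, α^{k+1})) ≤ γ_k / σ_k`, `γ_k ≥ 0`,
`∑ γ_k < ∞`, for some vectors `u^{k+1}`, `α^{k+1}`. -/
def CritA' (σ : ℕ → ℝ) (x : ℕ → Vec p) : Prop :=
  ∃ γ : ℕ → ℝ, (∀ k, 0 ≤ γ k) ∧ Summable γ ∧ ∃ u α : ℕ → Vec n,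
    ∀ k, Metric.infDist 0
      (proxKkt h A b lam (σ k) (x k) (triple (x (k + 1)) (u (k + 1)) (α (k + 1)))) ≤ γ k / σ k

/-- Criterion (B): `‖x^{k+1} - P_k(x^k)‖ ≤ δ_k ‖x^{k+1} - x^k‖`, `δ_k ≥ 0`, `∑ δ_k < ∞`. -/
def CritB (σ δ : ℕ → ℝ) (x : ℕ → Vec p) : Prop :=
  (∀ k, 0 ≤ δ k) ∧ Summable δ ∧
    ∀ k, ∃ y ∈ proxPoint h A b lam (σ k) (x k), ‖x (k + 1) - y‖ ≤ δ k * ‖x (k + 1) - x k‖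

/-- Criterion (B'): `dist(0, S_k(x^{k+1}, u^{k+1}, α^{k+1})) ≤ (δ_k / σ_k) ‖x^{k+1} - x^k‖`,
`δ_k ≥ 0`, `∑ δ_k < ∞`, for some vectors `u^{k+1}`, `α^{k+1}`. -/
def CritB' (σ δ : ℕ → ℝ) (x : ℕ → Vec p) : Prop :=
  (∀ k, 0 ≤ δ k) ∧ Summable δ ∧ ∃ u α : ℕ → Vec n,
    ∀ k, Metric.infDist 0
      (proxKkt h A b lam (σ k) (x k) (triple (x (k + 1)) (u (k + 1)) (α (k + 1)))) ≤
        δ k / σ k * ‖x (k + 1) - x k‖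

end Problem

/-- `μ_k = κ (κ² + σ_k²)^{-1/2}`. -/
def rateMu (κ s : ℝ) : ℝ := κ / Real.sqrt (κ ^ 2 + s ^ 2)

/-- `μ_∞ = κ (κ² + σ_∞²)^{-1/2}`, and `μ_∞ = 0` if `σ_∞ = ∞`. -/
def rateMuInf (κ : ℝ) (s : EReal) : ℝ := if s = ⊤ then 0 else rateMu κ s.toReal

/-- `θ_k = (μ_k + c δ_k) / (1 - δ_k)`. -/
def rateTheta (κ c : ℝ) (σ δ : ℕ → ℝ) (k : ℕ) : ℝ := (rateMu κ (σ k) + c * δ k) / (1 - δ k)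

/-- `θ_k → μ_∞`, and for all large `k`: `θ_k < 1` and
`‖x^{k+1} - x̄‖ ≤ θ_k ‖x^k - x̄‖`. -/
def HasLinearRate {p : ℕ} (κ c : ℝ) (σ δ : ℕ → ℝ) (σinf : EReal) (x : ℕ → Vec p)
    (xbar : Vec p) : Prop :=
  Tendsto (rateTheta κ c σ δ) atTop (𝓝 (rateMuInf κ σinf)) ∧
    ∃ K : ℕ, ∀ k ≥ K, rateTheta κ c σ δ k < 1 ∧
      ‖x (k + 1) - xbar‖ ≤ rateTheta κ c σ δ k * ‖x k - xbar‖

end HdrLasso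

end

/-!
The inexact proximal point algorithm converges for the following reasons.

*Convergence.* Under `(A)` the sequence is quasi-Fejér with respect to the solution set, with
summable errors. Criterion `(A')` does not imply `(A)`: a residual in the third component shifts the
argument of `h`, which can move the proximal point by more than a constant times the residual. But
the subgradient inequality at a solution (`inexact_step_inequality`) gives quasi-Fejér monotonicity
of the squared distances, with errors of the order of `γ k`. In both cases the steps tend to `0`,
cluster points satisfy the optimality conditions, and Opial's lemma (`exists_tendsto_of_fejer`)
yields the limit.

*Unique solution.* The proximal point of `x k` comes from a triple whose image under `T` contains
`((x k - P_k (x k)) / σ k, 0, 0)`. The existence of its multiplier is the sum and chain rule for the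
subdifferential, proved by separation in `exists_multiplier`. The error bound and firm
nonexpansiveness then give the factor `μ_k` (`critB_rate_of_subsingleton`).

*Polyhedral loss.* The graph of `T` is a finite union of polyhedra, given by the sets of active
affine functions. Hoffman's local error bound, proved by Fourier-Motzkin elimination
(`HoffmanBound.real_prod`), shows on each piece that small residuals are close to zeros of `T`, and
moreover that the multiplier of the nearby zero, placed at the original `(x, u)`, leaves no residual
but the infeasibility `b - A x - u` (`exists_upper_lipschitz`). Hence an error bound modulus exists,
and exact proximal points are eventually solutions. Under `(B)` the distances to the solution set
thus decay superlinearly, and the tangential drift is of smaller order, so that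
`‖x (k+1) - x̄‖ ≤ c δ_k / (1 - δ_k) ‖x k - x̄‖` eventually, for each `c > 1` (`critB_superlinear`).
This is within `R(c)`, and within `R(1)` if `μ_∞ > 0`. If `σ_∞ < ∞` and `μ_∞ = 0` then `κ = 0`,
which forces `0` to be the unique solution (`subsingleton_of_isErrorBoundModulus_zero`). Under
`(B')` the infeasibility is at most `δ_k / σ_k` times the step, so the new distance to the solution
set is at most `κ δ_k / σ_k` times the step, and the rate is eventually below `μ_k`
(`critB'_rate`).
-/

namespace HdrLasso

/-! ### Finite systems of linear inequalities -/

/-- A polyhedron: the solution set of a finite system of linear inequalities. -/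
def IsPolyhedron {E : Type*} [NormedAddCommGroup E] [NormedSpace ℝ E] (S : Set E) : Prop :=
  ∃ (m : ℕ) (l : Fin m → E →L[ℝ] ℝ) (b : Fin m → ℝ), S = {e | ∀ i, l i e ≤ b i}

/-- Hoffman's local error bound on `E`: for each finite system `l i e ≤ b i`, a point violating no
inequality by more than a small `s` lies within `K * s` of a solution. In particular an
infeasible system has no points of small violation. -/
def HoffmanBound (E : Type*) [NormedAddCommGroup E] [NormedSpace ℝ E] : Prop :=
  ∀ (ι : Type) [Fintype ι] (l : ι → E →L[ℝ] ℝ) (b : ι → ℝ),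
    ∃ K ε : ℝ, 0 ≤ K ∧ 0 < ε ∧ ∀ e s, 0 ≤ s → s < ε → (∀ i, l i e ≤ b i + s) →
      ∃ e', (∀ i, l i e' ≤ b i) ∧ ‖e - e'‖ ≤ K * s

lemma HoffmanBound.congr {E F : Type*} [NormedAddCommGroup E] [NormedSpace ℝ E]
    [NormedAddCommGroup F] [NormedSpace ℝ F] (φ : E ≃L[ℝ] F) (hE : HoffmanBound E) :
    HoffmanBound F := by
  intro ι _ l b
  obtain ⟨K, ε, hK, hε, H⟩ := hE ι (fun i => (l i).comp (φ : E →L[ℝ] F)) b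
  refine ⟨‖(φ : E →L[ℝ] F)‖ * K, ε, by positivity, hε, fun e s hs hsε he => ?_⟩
  obtain ⟨e', he', hd⟩ := H (φ.symm e) s hs hsε (fun i => by simpa using he i)
  refine ⟨φ e', fun i => by simpa using he' i, ?_⟩
  have h1 : e - φ e' = (φ : E →L[ℝ] F) (φ.symm e - e') := by simp
  rw [h1, mul_assoc]
  exact ((φ : E →L[ℝ] F).le_opNorm _).trans (by gcongr)

lemma hoffmanBound_of_subsingleton (E : Type*) [NormedAddCommGroup E] [NormedSpace ℝ E]
    [Subsingleton E] : HoffmanBound E := by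
  intro ι _ l b
  -- `ε` is smaller than every positive violation `-b i`.
  obtain ⟨ε, hε, H⟩ : ∃ ε > 0, ∀ i, 0 ≤ b i ∨ b i + ε ≤ 0 := by
    have : ∀ᶠ ε in 𝓝[>] (0 : ℝ), ∀ i, 0 ≤ b i ∨ b i + ε ≤ 0 := by
      rw [eventually_all]
      intro i
      rcases le_or_gt 0 (b i) with h | h
      · exact Eventually.of_forall fun _ => Or.inl h
      · filter_upwards [Ioo_mem_nhdsGT (show 0 < -b i by linarith)] with ε hε
        exact Or.inr (by linarith [hε.2])
    obtain ⟨ε, h1, h2⟩ := (this.and self_mem_nhdsWithin).exists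
    exact ⟨ε, h2, h1⟩
  refine ⟨0, ε, le_rfl, hε, fun e s hs hsε he => ⟨e, fun i => ?_, by simp⟩⟩
  have h0 : l i e = 0 := by rw [Subsingleton.elim e 0, map_zero]
  have := he i
  rcases H i with h | h <;> linarith

/-- Clamping `y` to the intervals `[lo j, hi i]` moves it by at most its violation. -/
lemma exists_clamp {ι : Type*} [Finite ι] (P Q : ι → Prop) (lo hi : ι → ℝ) (y r : ℝ) (hr : 0 ≤ r)
    (hle : ∀ i j, P i → Q j → lo j ≤ hi i) (hy1 : ∀ i, P i → y ≤ hi i + r)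
    (hy2 : ∀ j, Q j → lo j ≤ y + r) :
    ∃ y', (∀ i, P i → y' ≤ hi i) ∧ (∀ j, Q j → lo j ≤ y') ∧ |y - y'| ≤ r := by
  by_cases h1 : ∃ j, Q j ∧ y < lo j
  · obtain ⟨j, ⟨hj, hyj⟩, hmax⟩ := Set.exists_max_image {j | Q j ∧ y < lo j} lo (Set.toFinite _) h1
    refine ⟨lo j, fun i hi' => hle i j hi' hj, fun k hk => ?_, ?_⟩
    · by_cases h : y < lo k
      · exact hmax k ⟨hk, h⟩
      · linarith
    · rw [abs_le]; constructor <;> linarith [hy2 j hj]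
  · push Not at h1
    by_cases h2 : ∃ i, P i ∧ hi i < y
    · obtain ⟨i, ⟨hi', hyi⟩, hmin⟩ :=
        Set.exists_min_image {i | P i ∧ hi i < y} hi (Set.toFinite _) h2
      refine ⟨hi i, fun k hk => ?_, fun j hj => hle i j hi' hj, ?_⟩
      · by_cases h : hi k < y
        · exact hmin k ⟨hk, h⟩
        · linarith
      · rw [abs_le]; constructor <;> linarith [hy1 i hi']
    · push Not at h2
      exact ⟨y, h2, h1, by simpa using hr⟩

/-- One step of Fourier-Motzkin elimination: the variable in `ℝ` is eliminated, the remaining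
system is solved by hypothesis, and the eliminated variable is then clamped to the interval that
the inequalities leave for it. -/
lemma HoffmanBound.real_prod {E : Type*} [NormedAddCommGroup E] [NormedSpace ℝ E]
    (hE : HoffmanBound E) : HoffmanBound (ℝ × E) := by
  classical
  intro ι _ l b
  set c : ι → ℝ := fun i => l i (1, 0) with hc
  set m : ι → E →L[ℝ] ℝ := fun i => (l i).comp (ContinuousLinearMap.inr ℝ ℝ E) with hm
  have hl : ∀ i y x, l i (y, x) = c i * y + m i x := by
    intro i y x
    have : ((y, x) : ℝ × E) = y • ((1 : ℝ), (0 : E)) + (0, x) := by simp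
    rw [this, map_add, map_smul]
    simp [hc, hm, mul_comm]
  -- The eliminated system: a nonnegative combination for each pair of opposite signs, and the
  -- inequalities that do not involve the eliminated variable.
  obtain ⟨K, ε, hK, hε, H⟩ := hE (ι × ι ⊕ ι)
    (Sum.elim (fun q => if 0 < c q.1 ∧ c q.2 < 0 then (-c q.2) • m q.1 + c q.1 • m q.2 else 0)
      (fun i => if c i = 0 then m i else 0))
    (Sum.elim (fun q => if 0 < c q.1 ∧ c q.2 < 0 then (-c q.2) * b q.1 + c q.1 * b q.2 else 0)
      (fun i => if c i = 0 then b i else 0))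
  set C : ℝ := 1 + 2 * ∑ i, |c i| with hC
  have hcC : ∀ i, |c i| ≤ ∑ i, |c i| := fun i =>
    Finset.single_le_sum (f := fun i => |c i|) (fun _ _ => abs_nonneg _) (Finset.mem_univ i)
  have hsum : 0 ≤ ∑ i, |c i| := Finset.sum_nonneg fun _ _ => abs_nonneg _
  have hC1 : 1 ≤ C := by rw [hC]; linarith
  set R : ℝ := ∑ i, (‖m i‖ * (K * C) + 1) / |c i| with hR
  have hR0 : ∀ i, 0 ≤ (‖m i‖ * (K * C) + 1) / |c i| := fun i => by positivity
  have hRi : ∀ i, (‖m i‖ * (K * C) + 1) / |c i| ≤ R := fun i =>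
    Finset.single_le_sum (f := fun i => (‖m i‖ * (K * C) + 1) / |c i|)
      (fun i _ => hR0 i) (Finset.mem_univ i)
  have hRnn : 0 ≤ R := Finset.sum_nonneg fun i _ => hR0 i
  refine ⟨max R (K * C), ε / C, by positivity, by positivity, ?_⟩
  rintro ⟨y, x⟩ s hs hsε he
  simp only [hl] at he ⊢
  have hCs : C * s < ε := by rwa [lt_div_iff₀ (by positivity), mul_comm] at hsε
  obtain ⟨x', hx', hd⟩ := H x (C * s) (by positivity) hCs (by
    rintro (⟨i, j⟩ | i)
    · simp only [Sum.elim_inl]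
      split_ifs with hij
      · have h1 := mul_le_mul_of_nonneg_left (he i) (show 0 ≤ -c j by linarith [hij.2])
        have h2 := mul_le_mul_of_nonneg_left (he j) hij.1.le
        have h3 := hcC i
        have h4 := hcC j
        rw [abs_of_pos hij.1] at h3
        rw [abs_of_neg hij.2] at h4
        have h5 : (-c j + c i) * s ≤ C * s := by gcongr; rw [hC]; linarith
        simp only [add_apply, smul_apply, smul_eq_mul]
        nlinarith
      · simp only [zero_apply]; positivity
    · simp only [Sum.elim_inr]
      split_ifs with hi
      · have := he i
        rw [hi] at this
        nlinarith
      · simp only [zero_apply]; positivity)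
  have hmx : ∀ i, m i x' ≤ m i x + ‖m i‖ * (K * C) * s := by
    intro i
    have h1 : m i x' - m i x ≤ ‖m i‖ * ‖x - x'‖ := by
      rw [← map_sub, ← norm_sub_rev]
      exact (le_abs_self _).trans ((m i).le_opNorm _)
    have h2 : ‖m i‖ * ‖x - x'‖ ≤ ‖m i‖ * (K * (C * s)) := by gcongr
    linarith
  have key : ∀ i, c i ≠ 0 → (‖m i‖ * (K * C) + 1) * s ≤ |c i| * (R * s) := by
    intro i hi
    have h1 := hRi i
    rw [div_le_iff₀ (abs_pos.2 hi)] at h1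
    nlinarith
  obtain ⟨y', hy1, hy2, hy3⟩ := exists_clamp (fun i => 0 < c i) (fun i => c i < 0)
    (fun i => (b i - m i x') / c i) (fun i => (b i - m i x') / c i) y (R * s) (by positivity)
    (by
      intro i j hi hj
      have h1 := hx' (Sum.inl (i, j))
      simp only [Sum.elim_inl, hi, hj, and_self, if_true, add_apply,
        smul_apply, smul_eq_mul] at h1
      rw [div_le_iff_of_neg hj, div_mul_eq_mul_div, div_le_iff₀ hi]
      nlinarith)
    (by
      intro i hi
      have h1 := key i hi.ne'
      rw [abs_of_pos hi] at h1
      rw [← sub_le_iff_le_add, le_div_iff₀ hi]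
      have := he i
      have := hmx i
      nlinarith)
    (by
      intro i hi
      have h1 := key i hi.ne
      rw [abs_of_neg hi] at h1
      rw [div_le_iff_of_neg hi]
      have := he i
      have := hmx i
      nlinarith)
  refine ⟨(y', x'), fun i => ?_, ?_⟩
  · rcases lt_trichotomy (c i) 0 with hi | hi | hi
    · have := hy2 i hi
      rw [div_le_iff_of_neg hi] at this
      linarith
    · have := hx' (Sum.inr i)
      simp only [Sum.elim_inr, hi, if_true] at this
      rw [hi]; linarith
    · have := hy1 i hi
      rw [le_div_iff₀ hi] at this
      linarith
  · rw [Prod.norm_def]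
    simp only [Prod.fst_sub, Prod.snd_sub, Real.norm_eq_abs]
    refine max_le (hy3.trans ?_) (hd.trans ?_)
    · gcongr; exact le_max_left _ _
    · rw [← mul_assoc]; gcongr; exact le_max_right _ _

lemma hoffmanBound (E : Type*) [NormedAddCommGroup E] [NormedSpace ℝ E] [FiniteDimensional ℝ E] :
    HoffmanBound E := by
  have key : ∀ d : ℕ, HoffmanBound (Fin d → ℝ) := by
    intro d
    induction d with
    | zero => exact hoffmanBound_of_subsingleton _
    | succ d ih =>
      exact ih.real_prod.congr (ContinuousLinearEquiv.ofFinrankEq (by simp [add_comm]))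
  exact (key (Module.finrank ℝ E)).congr (ContinuousLinearEquiv.ofFinrankEq (by simp))

section Polyhedron

variable {E F : Type*} [NormedAddCommGroup E] [NormedSpace ℝ E]
  [NormedAddCommGroup F] [NormedSpace ℝ F]

lemma isPolyhedron_of_fintype {ι : Type*} [Fintype ι] (l : ι → E →L[ℝ] ℝ) (b : ι → ℝ) :
    IsPolyhedron {e | ∀ i, l i e ≤ b i} := by
  let φ := Fintype.equivFin ι
  refine ⟨Fintype.card ι, l ∘ φ.symm, b ∘ φ.symm, ?_⟩
  ext e
  exact ⟨fun h i => h _, fun h i => by simpa using h (φ i)⟩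

lemma isPolyhedron_univ : IsPolyhedron (Set.univ : Set E) :=
  ⟨0, fun _ => 0, fun _ => 0, by ext; simp⟩

lemma isPolyhedron_le (l : E →L[ℝ] ℝ) (b : ℝ) : IsPolyhedron {e | l e ≤ b} :=
  ⟨1, fun _ => l, fun _ => b, by ext; simp⟩

lemma IsPolyhedron.iInter {ι : Type*} [Fintype ι] {S : ι → Set E}
    (h : ∀ i, IsPolyhedron (S i)) : IsPolyhedron (⋂ i, S i) := by
  choose m l b hS using h
  have := isPolyhedron_of_fintype (E := E) (ι := Σ i, Fin (m i)) (fun q => l q.1 q.2)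
    (fun q => b q.1 q.2)
  convert this using 1
  ext e
  simp only [hS, Set.mem_iInter, Set.mem_ofPred_eq, Sigma.forall]

lemma IsPolyhedron.inter {S T : Set E} (hS : IsPolyhedron S) (hT : IsPolyhedron T) :
    IsPolyhedron (S ∩ T) := by
  rw [Set.inter_eq_iInter]
  exact IsPolyhedron.iInter (fun i => by cases i <;> assumption)

lemma IsPolyhedron.preimage {S : Set F} (hS : IsPolyhedron S) (φ : E →L[ℝ] F) :
    IsPolyhedron (φ ⁻¹' S) := by
  obtain ⟨m, l, b, rfl⟩ := hS
  exact ⟨m, fun i => (l i).comp φ, b, rfl⟩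

/-- Hoffman's bound relative to a polyhedron `S` on which only the linear equation `B e = c` is
violated. -/
lemma IsPolyhedron.exists_hoffman [FiniteDimensional ℝ E] [FiniteDimensional ℝ F]
    {S : Set E} (hS : IsPolyhedron S) (B : E →L[ℝ] F) (c : F) :
    ∃ K ε : ℝ, 0 ≤ K ∧ 0 < ε ∧ ∀ e ∈ S, ‖B e - c‖ < ε →
      ∃ e' ∈ S, B e' = c ∧ ‖e - e'‖ ≤ K * ‖B e - c‖ := by
  obtain ⟨m, l, b, rfl⟩ := hS
  let φ : F ≃L[ℝ] (Fin (Module.finrank ℝ F) → ℝ) := ContinuousLinearEquiv.ofFinrankEq (by simp)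
  set M : ℝ := ‖(φ : F →L[ℝ] (Fin (Module.finrank ℝ F) → ℝ))‖ + 1 with hM
  have hM0 : 0 < M := by positivity
  let π : Fin (Module.finrank ℝ F) → E →L[ℝ] ℝ := fun j =>
    (ContinuousLinearMap.proj j).comp
      ((φ : F →L[ℝ] (Fin (Module.finrank ℝ F) → ℝ)).comp B)
  obtain ⟨K, ε, hK, hε, H⟩ := hoffmanBound E (Fin m ⊕ (Fin (Module.finrank ℝ F) ⊕
      Fin (Module.finrank ℝ F)))
    (Sum.elim l (Sum.elim π (fun j => -π j)))
    (Sum.elim b (Sum.elim (φ c) (fun j => -φ c j)))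
  refine ⟨K * M, ε / M, by positivity, by positivity, fun e he hlt => ?_⟩
  have hφ : ∀ j, |φ (B e) j - φ c j| ≤ M * ‖B e - c‖ := by
    intro j
    have h1 : φ (B e) j - φ c j = (φ : F →L[ℝ] (Fin (Module.finrank ℝ F) → ℝ)) (B e - c) j := by
      simp
    rw [h1, ← Real.norm_eq_abs]
    refine (norm_le_pi_norm _ j).trans ((ContinuousLinearMap.le_opNorm _ _).trans ?_)
    gcongr
    rw [hM]; linarith
  obtain ⟨e', he', hd⟩ := H e (M * ‖B e - c‖) (by positivity)
    (by rwa [lt_div_iff₀ hM0, mul_comm] at hlt) (by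
      rintro (i | j | j)
      · have := he i
        simp only [Sum.elim_inl]
        have : 0 ≤ M * ‖B e - c‖ := by positivity
        linarith [he i]
      · have := (abs_le.1 (hφ j)).2
        simp only [Sum.elim_inr, Sum.elim_inl]
        change φ (B e) j ≤ _
        linarith
      · have := (abs_le.1 (hφ j)).1
        simp only [Sum.elim_inr]
        change -φ (B e) j ≤ _
        linarith)
  refine ⟨e', fun i => he' (Sum.inl i), ?_, by rwa [mul_assoc]⟩
  apply φ.injective
  ext j
  have h1 : φ (B e') j ≤ φ c j := he' (Sum.inr (Sum.inl j))
  have h2 : -φ (B e') j ≤ -φ c j := he' (Sum.inr (Sum.inr j))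
  linarith

end Polyhedron

/-! ### Triples and the `ℓ¹` norm -/

section Triples

variable {p n : ℕ}

lemma norm_triple_sq (x : Vec p) (u α : Vec n) :
    ‖triple x u α‖ ^ 2 = ‖x‖ ^ 2 + ‖u‖ ^ 2 + ‖α‖ ^ 2 := by
  unfold triple
  rw [WithLp.prod_norm_sq_eq_of_L2, WithLp.prod_norm_sq_eq_of_L2]
  exact (add_assoc _ _ _).symm

lemma norm_le_norm_triple (x : Vec p) (u α : Vec n) :
    ‖x‖ ≤ ‖triple x u α‖ ∧ ‖u‖ ≤ ‖triple x u α‖ ∧ ‖α‖ ≤ ‖triple x u α‖ := by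
  have h := norm_triple_sq x u α
  refine ⟨?_, ?_, ?_⟩ <;> refine le_of_sq_le_sq ?_ (norm_nonneg _) <;>
    nlinarith [sq_nonneg ‖x‖, sq_nonneg ‖u‖, sq_nonneg ‖α‖]

lemma norm_triple_le (x : Vec p) (u α : Vec n) :
    ‖triple x u α‖ ≤ ‖x‖ + ‖u‖ + ‖α‖ := by
  refine le_of_sq_le_sq ?_ (by positivity)
  rw [norm_triple_sq]
  nlinarith [mul_nonneg (norm_nonneg x) (norm_nonneg u), mul_nonneg (norm_nonneg x) (norm_nonneg α),
    mul_nonneg (norm_nonneg u) (norm_nonneg α)]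

lemma norm_triple_zero_zero (x : Vec p) : ‖triple x (0 : Vec n) 0‖ = ‖x‖ := by
  have h := norm_triple_sq x (0 : Vec n) 0
  simp only [norm_zero, ne_eq, OfNat.ofNat_ne_zero, not_false_eq_true, zero_pow, add_zero] at h
  exact (sq_eq_sq₀ (norm_nonneg _) (norm_nonneg _)).1 h

lemma norm_triple_zero_zero_right (w : Vec n) : ‖triple (0 : Vec p) (0 : Vec n) w‖ = ‖w‖ := by
  have h := norm_triple_sq (0 : Vec p) (0 : Vec n) w
  simp only [norm_zero, ne_eq, OfNat.ofNat_ne_zero, not_false_eq_true, zero_pow, zero_add] at h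
  exact (sq_eq_sq₀ (norm_nonneg _) (norm_nonneg _)).1 h

lemma exists_eq_triple (z : Triple p n) : ∃ x u α, z = triple x u α :=
  ⟨z.fst, z.snd.fst, z.snd.snd, rfl⟩

lemma triple_sub (x x' : Vec p) (u α u' α' : Vec n) :
    triple x u α - triple x' u' α' = triple (x - x') (u - u') (α - α') := rfl

lemma smul_triple (s : ℝ) (x : Vec p) (u α : Vec n) :
    s • triple x u α = triple (s • x) (s • u) (s • α) := rfl

lemma triple_zero : triple (0 : Vec p) (0 : Vec n) 0 = 0 := rfl

lemma triple_inj {x x' : Vec p} {u α u' α' : Vec n} :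
    triple x u α = triple x' u' α' ↔ x = x' ∧ u = u' ∧ α = α' := by
  constructor
  · intro h
    exact ⟨congrArg (fun z => z.fst) h, congrArg (fun z => z.snd.fst) h,
      congrArg (fun z => z.snd.snd) h⟩
  · rintro ⟨rfl, rfl, rfl⟩; rfl

end Triples

section L1

variable {d : ℕ}

lemma l1_nonneg (x : Vec d) : 0 ≤ l1 x := Finset.sum_nonneg fun _ _ => abs_nonneg _

lemma l1_smul (s : ℝ) (x : Vec d) : l1 (s • x) = |s| * l1 x := by
  simp [l1, abs_mul, Finset.mul_sum]

lemma l1_add_le (x y : Vec d) : l1 (x + y) ≤ l1 x + l1 y := by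
  rw [l1, l1, l1, ← Finset.sum_add_distrib]
  exact Finset.sum_le_sum fun i _ => abs_add_le _ _

lemma l1_zero : l1 (0 : Vec d) = 0 := by simp [l1]

lemma continuous_l1 : Continuous (l1 : Vec d → ℝ) := by
  unfold l1; fun_prop

lemma convexOn_l1 : ConvexOn ℝ univ (l1 : Vec d → ℝ) := by
  refine ⟨convex_univ, fun x _ y _ a b ha hb _ => ?_⟩
  refine (l1_add_le _ _).trans ?_
  simp [l1_smul, abs_of_nonneg ha, abs_of_nonneg hb]

lemma norm_le_l1 (x : Vec d) : ‖x‖ ≤ l1 x := by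
  refine le_of_sq_le_sq ?_ (l1_nonneg x)
  rw [EuclideanSpace.norm_sq_eq]
  calc ∑ i, ‖x i‖ ^ 2 ≤ ∑ i, |x i| * l1 x := by
        refine Finset.sum_le_sum fun i _ => ?_
        rw [Real.norm_eq_abs, sq]
        exact mul_le_mul_of_nonneg_left
          (Finset.single_le_sum (f := fun i => |x i|) (fun _ _ => abs_nonneg _) (Finset.mem_univ i))
          (abs_nonneg _)
    _ = l1 x ^ 2 := by rw [← Finset.sum_mul, sq]; rfl

/-- The subdifferential of the positively homogeneous function `‖·‖₁` is constant along rays. -/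
lemma subdiff_l1_smul {g x : Vec d} (hg : g ∈ subdiff l1 x) {s : ℝ} (hs : 0 ≤ s) :
    g ∈ subdiff l1 (s • x) := by
  have h0 := hg 0
  have h2 := hg ((2 : ℝ) • x)
  rw [l1_smul, abs_of_pos two_pos, two_smul, add_sub_cancel_right] at h2
  rw [l1_zero, zero_sub, inner_neg_right] at h0
  have hx : ⟪g, x⟫ = l1 x := by linarith
  intro y
  have hy := hg y
  rw [inner_sub_right] at hy
  rw [l1_smul, abs_of_nonneg hs, inner_sub_right, inner_smul_right, hx]
  linarith

end L1

/-! ### Subgradients and the optimality conditions -/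

lemma isClosed_subdiff {d : ℕ} (f : Vec d → ℝ) (x : Vec d) : IsClosed (subdiff f x) := by
  rw [show subdiff f x = ⋂ y, {g | f x + ⟪g, y - x⟫ ≤ f y} by ext; simp [subdiff]]
  exact isClosed_iInter fun y => isClosed_le (by fun_prop) continuous_const

lemma subdiff_monotone {d : ℕ} {f : Vec d → ℝ} {x y g k : Vec d} (hg : g ∈ subdiff f x)
    (hk : k ∈ subdiff f y) : 0 ≤ ⟪g - k, x - y⟫ := by
  have h1 := hg y
  have h2 := hk x
  rw [← neg_sub x y, inner_neg_right] at h1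
  rw [inner_sub_left]
  linarith

section Kkt

variable {p n : ℕ} {h : Vec n → ℝ} {A : Vec p →L[ℝ] Vec n} {b : Vec n} {lam : ℝ}

lemma continuous_objective (hh : ConvexOn ℝ univ h) : Continuous (objective h A b lam) := by
  have := hh.locallyLipschitz.continuous
  have := continuous_l1 (d := p)
  unfold objective
  fun_prop

lemma convexOn_objective (hh : ConvexOn ℝ univ h) (hlam : 0 < lam) :
    ConvexOn ℝ univ (objective h A b lam) := by
  refine ConvexOn.add ?_ (convexOn_l1.smul hlam.le)
  refine ⟨convex_univ, fun x _ y _ s t hs ht hst => ?_⟩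
  have := hh.2 (mem_univ (b - A x)) (mem_univ (b - A y)) hs ht hst
  convert this using 2
  rw [map_add, map_smul, map_smul, smul_sub, smul_sub]
  nth_rewrite 1 [← one_smul ℝ b]
  rw [← hst, add_smul]
  abel

/-- The sum and chain rules for the subdifferential of the objective, in the form of a Lagrange
multiplier: the strict epigraph of `h` is separated from the hypograph of
`b - A x' ↦ m - λ‖x'‖₁ + ⟪c, x'⟫`, where `m` is the minimum. -/
lemma exists_multiplier (hh : ConvexOn ℝ univ h) (hlam : 0 < lam) (c x : Vec p)
    (hmin : ∀ x', objective h A b lam x + ⟪c, x' - x⟫ ≤ objective h A b lam x') :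
    ∃ v ∈ subdiff h (b - A x), ∃ g ∈ subdiff l1 x,
      lam • g - ContinuousLinearMap.adjoint A v = c := by
  have hcont := hh.locallyLipschitz.continuous
  set u := b - A x with hu
  let E1 : Set (Vec n × ℝ) := {q | h q.1 < q.2}
  let E2 : Set (Vec n × ℝ) := {q | ∃ x', q.1 = b - A x' ∧
    q.2 ≤ h u + lam * l1 x - lam * l1 x' + ⟪c, x' - x⟫}
  have hE1 : Convex ℝ E1 := by
    have := hh.convex_strict_epigraph
    simpa [E1] using this
  have hE1o : IsOpen E1 := isOpen_lt (by fun_prop) continuous_snd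
  have hE2 : Convex ℝ E2 := by
    rintro ⟨u1, r1⟩ ⟨x1, h1, h1'⟩ ⟨u2, r2⟩ ⟨x2, h2, h2'⟩ s t hs ht hst
    simp only at h1 h1' h2 h2'
    refine ⟨s • x1 + t • x2, ?_, ?_⟩
    · simp only [Prod.smul_mk, Prod.mk_add_mk, h1, h2, map_add, map_smul, smul_sub]
      nth_rewrite 3 [← one_smul ℝ b]
      rw [← hst, add_smul]
      abel
    · have h3 := convexOn_l1.2 (mem_univ x1) (mem_univ x2) hs ht hst
      have h4 : ⟪c, s • x1 + t • x2 - x⟫ = s * ⟪c, x1 - x⟫ + t * ⟪c, x2 - x⟫ := by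
        have : s • x1 + t • x2 - x = s • (x1 - x) + t • (x2 - x) := by
          rw [smul_sub, smul_sub]
          nth_rewrite 1 [← one_smul ℝ x]
          rw [← hst, add_smul]
          abel
        rw [this, inner_add_right, inner_smul_right, inner_smul_right]
      simp only [Prod.smul_mk, Prod.mk_add_mk, smul_eq_mul] at h3 ⊢
      rw [h4]
      have h5 := mul_le_mul_of_nonneg_left h1' hs
      have h6 := mul_le_mul_of_nonneg_left h2' ht
      have h7 := mul_le_mul_of_nonneg_left h3 hlam.le
      obtain rfl : t = 1 - s := by linarith
      linarith
  have hdisj : Disjoint E1 E2 := by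
    rw [Set.disjoint_left]
    rintro ⟨u', r⟩ h1 ⟨x', h2, h3⟩
    simp only [E1, mem_ofPred_eq] at h1
    simp only at h2 h3
    have := hmin x'
    unfold objective at this
    rw [← h2, ← hu] at this
    linarith
  obtain ⟨f, s, hf1, hf2⟩ := geometric_hahn_banach_open hE1 hE1o hE2 hdisj
  let φ : Vec n →L[ℝ] ℝ := f.comp (ContinuousLinearMap.inl ℝ (Vec n) ℝ)
  set v0 : Vec n := (InnerProductSpace.toDual ℝ (Vec n)).symm φ with hv0
  set β := f (0, 1) with hβ
  have hf : ∀ u' r, f (u', r) = ⟪v0, u'⟫ + β * r := by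
    intro u' r
    have h1 : ((u', r) : Vec n × ℝ) = (u', 0) + r • (0, 1) := by simp
    rw [h1, map_add, map_smul, hv0, InnerProductSpace.toDual_symm_apply]
    simp [φ, hβ, mul_comm]
  have h1 : s ≤ ⟪v0, u⟫ + β * h u := by
    rw [← hf]
    exact hf2 _ ⟨x, hu, by simp⟩
  have h2 : ⟪v0, u⟫ + β * (h u + 1) < s := by
    rw [← hf]
    exact hf1 _ (by simp [E1])
  have hβneg : β < 0 := by nlinarith
  have h3 : ∀ u', ⟪v0, u'⟫ + β * h u' ≤ s := by
    intro u'
    refine le_of_forall_pos_le_add fun ε hε => ?_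
    have := hf1 (u', h u' + ε / (-β)) (by
      have : 0 < ε / (-β) := div_pos hε (by linarith)
      simpa [E1])
    rw [hf] at this
    have h4 : β * (ε / (-β)) = -ε := by field_simp [hβneg.ne]
    rw [mul_add, h4] at this
    linarith
  have h4 : ∀ x', s ≤ ⟪v0, b - A x'⟫ +
      β * (h u + lam * l1 x - lam * l1 x' + ⟪c, x' - x⟫) := by
    intro x'
    rw [← hf]
    exact hf2 _ ⟨x', rfl, le_rfl⟩
  have hb : 0 < (-β)⁻¹ := by rw [inv_pos]; linarith
  have hbb : (-β)⁻¹ * β = -1 := by field_simp [hβneg.ne]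
  refine ⟨(-β)⁻¹ • v0, fun u' => ?_, lam⁻¹ • (c + ContinuousLinearMap.adjoint A ((-β)⁻¹ • v0)),
    fun x' => ?_, by rw [smul_inv_smul₀ hlam.ne']; abel⟩
  · have h5 := mul_le_mul_of_nonneg_left ((h3 u').trans h1) hb.le
    rw [mul_add, mul_add, ← mul_assoc, ← mul_assoc, hbb] at h5
    rw [inner_smul_left, inner_sub_right]
    simp only [conj_trivial]
    linarith
  · have h5 := mul_le_mul_of_nonneg_left ((h3 u).trans (h4 x')) hb.le
    rw [mul_add, mul_add, ← mul_assoc, ← mul_assoc, hbb] at h5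
    rw [inner_smul_left, inner_add_left, ContinuousLinearMap.adjoint_inner_left, inner_smul_left]
    simp only [conj_trivial]
    have h6 : ⟪v0, b - A x'⟫ = ⟪v0, u⟫ - ⟪v0, A (x' - x)⟫ := by
      rw [← inner_sub_right, hu, map_sub]; congr 1; abel
    rw [h6] at h5
    have h7 : ⟪c, x' - x⟫ + (-β)⁻¹ * ⟪v0, A (x' - x)⟫ ≤ lam * l1 x' - lam * l1 x := by linarith
    have h8 := mul_le_mul_of_nonneg_left h7 (inv_pos.2 hlam).le
    have h9 : lam⁻¹ * (lam * l1 x' - lam * l1 x) = l1 x' - l1 x := by field_simp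
    linarith

lemma subdiff_nonempty (hh : ConvexOn ℝ univ h) (u : Vec n) : (subdiff h u).Nonempty := by
  obtain ⟨v, hv, -⟩ := exists_multiplier (A := (0 : Vec 0 →L[ℝ] Vec n)) (b := u) hh one_pos 0 0
    (fun x' => by simp [objective, l1])
  exact ⟨v, by simpa using hv⟩

lemma mem_kkt_iff {x w1 : Vec p} {u α w2 w3 : Vec n} :
    triple w1 w2 w3 ∈ kkt h A b lam (triple x u α) ↔
      (∃ g ∈ subdiff l1 x, lam • g - ContinuousLinearMap.adjoint A α = w1) ∧
        α + w2 ∈ subdiff h u ∧ b - A x - u = w3 := by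
  constructor
  · rintro ⟨g, hg, v, hv, e⟩
    rw [triple_inj] at e
    obtain ⟨e1, e2, e3⟩ := e
    refine ⟨⟨g, hg, ?_⟩, ?_, ?_⟩
    · rw [e1]; change _ = -(ContinuousLinearMap.adjoint A α) + lam • g; abel
    · rw [e2]
      change α + (v - α) ∈ subdiff h u
      rw [add_sub_cancel]
      exact hv
    · rw [e3]; change _ = -u + b - A x; abel
  · rintro ⟨⟨g, hg, e1⟩, hv, e3⟩
    refine ⟨g, hg, α + w2, hv, ?_⟩
    rw [triple_inj]
    refine ⟨?_, ?_, ?_⟩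
    · rw [← e1]; change _ = -(ContinuousLinearMap.adjoint A α) + lam • g; abel
    · change _ = α + w2 - α; abel
    · rw [← e3]; change _ = -u + b - A x; abel

lemma zero_mem_kkt_iff {x : Vec p} {u α : Vec n} :
    0 ∈ kkt h A b lam (triple x u α) ↔
      (∃ g ∈ subdiff l1 x, lam • g = ContinuousLinearMap.adjoint A α) ∧
        α ∈ subdiff h u ∧ u = b - A x := by
  rw [← triple_zero, mem_kkt_iff, add_zero]
  rw [sub_eq_zero, eq_comm (a := u)]
  simp only [sub_eq_zero]

lemma kkt_nonempty (hh : ConvexOn ℝ univ h) (z : Triple p n) : (kkt h A b lam z).Nonempty := by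
  obtain ⟨g, hg⟩ := subdiff_nonempty convexOn_l1 z.fst
  obtain ⟨v, hv⟩ := subdiff_nonempty hh z.snd.fst
  exact ⟨_, g, hg, v, hv, rfl⟩

lemma isClosed_kkt (hlam : 0 < lam) (z : Triple p n) : IsClosed (kkt h A b lam z) := by
  obtain ⟨x, u, α, rfl⟩ := exists_eq_triple z
  have : kkt h A b lam (triple x u α) =
      {w | lam⁻¹ • (w.fst + ContinuousLinearMap.adjoint A α) ∈ subdiff l1 x} ∩
      ({w | α + w.snd.fst ∈ subdiff h u} ∩ {w | b - A x - u = w.snd.snd}) := by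
    ext w
    obtain ⟨w1, w2, w3, rfl⟩ := exists_eq_triple w
    rw [mem_kkt_iff]
    refine and_congr ⟨?_, fun hw => ⟨_, hw, ?_⟩⟩ Iff.rfl
    · rintro ⟨g, hg, rfl⟩
      change lam⁻¹ • (lam • g - ContinuousLinearMap.adjoint A α +
        ContinuousLinearMap.adjoint A α) ∈ subdiff l1 x
      rwa [sub_add_cancel, inv_smul_smul₀ hlam.ne']
    · rw [smul_inv_smul₀ hlam.ne']
      change w1 + ContinuousLinearMap.adjoint A α - ContinuousLinearMap.adjoint A α = w1
      abel
  rw [this]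
  refine ((isClosed_subdiff l1 x).preimage ?_).inter
    (((isClosed_subdiff h u).preimage ?_).inter (isClosed_eq continuous_const ?_)) <;> fun_prop

lemma infDist_zero_kkt_le {z w : Triple p n} (hw : w ∈ kkt h A b lam z) :
    Metric.infDist 0 (kkt h A b lam z) ≤ ‖w‖ := by
  simpa using Metric.infDist_le_dist_of_mem hw (x := 0)

lemma exists_mem_kkt_norm_eq (hh : ConvexOn ℝ univ h) (hlam : 0 < lam) (z : Triple p n) :
    ∃ w ∈ kkt h A b lam z, ‖w‖ = Metric.infDist 0 (kkt h A b lam z) := by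
  obtain ⟨w, hw, e⟩ := (isClosed_kkt hlam z).exists_infDist_eq_dist (kkt_nonempty hh z) 0
  exact ⟨w, hw, by rw [e, dist_zero_left]⟩

/-- The distance of `0` to `S(x,u,α)` is attained, at a residual with components `w1, w2, w3`. -/
lemma exists_residual (hh : ConvexOn ℝ univ h) (hlam : 0 < lam) (s : ℝ) (y x : Vec p)
    (u α : Vec n) {r : ℝ}
    (hr : Metric.infDist 0 (proxKkt h A b lam s y (triple x u α)) ≤ r) :
    ∃ w1 w2 w3, ‖w1‖ ≤ r ∧ ‖w2‖ ≤ r ∧ ‖w3‖ ≤ r ∧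
      triple (w1 - (1 / s) • (x - y)) w2 w3 ∈ kkt h A b lam (triple x u α) := by
  have himg : proxKkt h A b lam s y (triple x u α) =
      (fun w => w - (1 / s) • triple (x - y) (0 : Vec n) 0) ⁻¹' kkt h A b lam (triple x u α) := by
    ext w
    constructor
    · rintro ⟨w', hw', rfl⟩
      rw [mem_preimage]
      convert hw' using 1
      exact add_sub_cancel_right _ _
    · intro hw
      exact ⟨_, hw, (sub_add_cancel _ _).symm⟩
  have hcl : IsClosed (proxKkt h A b lam s y (triple x u α)) := by
    rw [himg]
    exact (isClosed_kkt hlam _).preimage (by fun_prop)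
  have hne : (proxKkt h A b lam s y (triple x u α)).Nonempty := by
    obtain ⟨w', hw'⟩ := kkt_nonempty (A := A) (b := b) (lam := lam) hh (triple x u α)
    exact ⟨_, w', hw', rfl⟩
  obtain ⟨w, hw, e⟩ := hcl.exists_infDist_eq_dist hne 0
  rw [e, dist_zero_left] at hr
  obtain ⟨w1, w2, w3, rfl⟩ := exists_eq_triple w
  obtain ⟨h1, h2, h3⟩ := norm_le_norm_triple w1 w2 w3
  refine ⟨w1, w2, w3, h1.trans hr, h2.trans hr, h3.trans hr, ?_⟩
  rw [himg, mem_preimage, smul_triple, triple_sub] at hw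
  simpa using hw

/-- The subgradient inequality of the objective in which the argument of `h` is shifted by `w`. -/
lemma shifted_subgradient_le (hlam : 0 < lam) {x g : Vec p} {v w : Vec n}
    (hg : g ∈ subdiff l1 x) (hv : v ∈ subdiff h (b - A x - w)) (y : Vec p) :
    h (b - A x - w) + lam * l1 x + ⟪lam • g - ContinuousLinearMap.adjoint A v, y - x⟫ ≤
      h (b - A y - w) + lam * l1 y := by
  have h1 := hv (b - A y - w)
  have h2 := mul_le_mul_of_nonneg_left (hg y) hlam.le
  have h3 : b - A y - w - (b - A x - w) = -(A (y - x)) := by rw [map_sub]; abel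
  rw [h3, inner_neg_right] at h1
  rw [inner_sub_left, inner_smul_left, ContinuousLinearMap.adjoint_inner_left]
  simp only [conj_trivial]
  linarith

lemma mem_solutions_of_zero_mem_kkt (hlam : 0 < lam) {x : Vec p} {u α : Vec n}
    (hz : 0 ∈ kkt h A b lam (triple x u α)) : x ∈ solutions h A b lam := by
  obtain ⟨⟨g, hg, e⟩, hα, rfl⟩ := zero_mem_kkt_iff.1 hz
  intro y
  have := shifted_subgradient_le (w := 0) hlam hg (by rwa [sub_zero]) y
  simpa [e, objective] using this

lemma exists_zero_mem_kkt (hh : ConvexOn ℝ univ h) (hlam : 0 < lam) {x : Vec p}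
    (hx : x ∈ solutions h A b lam) : ∃ α, 0 ∈ kkt h A b lam (triple x (b - A x) α) := by
  obtain ⟨v, hv, g, hg, e⟩ := exists_multiplier (A := A) (b := b) hh hlam 0 x
    (fun x' => by simpa using hx x')
  exact ⟨v, zero_mem_kkt_iff.2 ⟨⟨g, hg, sub_eq_zero.1 e⟩, hv, rfl⟩⟩

/-- The zeros of `T` are the products of primal and dual solutions: each multiplier belongs to
every solution. -/
lemma zero_mem_kkt_of_mem_solutions (hlam : 0 < lam) {x x' : Vec p} {u α : Vec n}
    (hx' : x' ∈ solutions h A b lam) (hz : 0 ∈ kkt h A b lam (triple x u α)) :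
    0 ∈ kkt h A b lam (triple x' (b - A x') α) := by
  obtain ⟨⟨g, hg, e⟩, hα, rfl⟩ := zero_mem_kkt_iff.1 hz
  have h1 := hα (b - A x')
  have h2 := mul_le_mul_of_nonneg_left (hg x') hlam.le
  have h3 := hx' x
  unfold objective at h3
  have h4 : b - A x' - (b - A x) = -(A (x' - x)) := by rw [map_sub]; abel
  rw [h4, inner_neg_right] at h1
  have h5 : lam * ⟪g, x' - x⟫ = ⟪α, A (x' - x)⟫ := by
    rw [← ContinuousLinearMap.adjoint_inner_left, ← e, inner_smul_left]; simp
  rw [mul_add, h5] at h2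
  refine zero_mem_kkt_iff.2 ⟨⟨g, fun y => ?_, e⟩, fun y => ?_, rfl⟩
  · have h6 := hg y
    have h7 : lam * l1 x' = lam * (l1 x + ⟪g, x' - x⟫) := by rw [mul_add, h5]; linarith
    have h8 := mul_left_cancel₀ hlam.ne' h7
    have h9 : ⟪g, y - x⟫ = ⟪g, y - x'⟫ + ⟪g, x' - x⟫ := by
      rw [← inner_add_right]; congr 1; abel
    linarith
  · have h6 := hα y
    have h9 : ⟪α, y - (b - A x)⟫ = ⟪α, y - (b - A x')⟫ - ⟪α, A (x' - x)⟫ := by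
      rw [← inner_sub_right, map_sub]; congr 1; abel
    linarith

/-- The variational inequality of a proximal point. -/
lemma proxPoint_inequality (hh : ConvexOn ℝ univ h) (hlam : 0 < lam) {s : ℝ}
    {x₀ y : Vec p} (hy : y ∈ proxPoint h A b lam s x₀) (z : Vec p) :
    objective h A b lam y + ⟪(1 / s) • (x₀ - y), z - y⟫ ≤ objective h A b lam z := by
  set f := objective h A b lam with hf
  have key : ∀ t : ℝ, 0 < t → t ≤ 1 →
      f y + ⟪(1 / s) • (x₀ - y), z - y⟫ ≤ f z + t * (1 / (2 * s) * ‖z - y‖ ^ 2) := by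
    intro t ht ht1
    have h1 := hy (y + t • (z - y))
    simp only at h1
    have h2 := (convexOn_objective (A := A) (b := b) hh hlam).2 (mem_univ y) (mem_univ z)
      (show 0 ≤ 1 - t by linarith) ht.le (by ring)
    have h3 : (1 - t) • y + t • z = y + t • (z - y) := by module
    rw [h3] at h2
    have h4 : ‖y + t • (z - y) - x₀‖ ^ 2 =
        ‖y - x₀‖ ^ 2 - 2 * t * ⟪x₀ - y, z - y⟫ + t ^ 2 * ‖z - y‖ ^ 2 := by
      have : y + t • (z - y) - x₀ = (y - x₀) + t • (z - y) := by abel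
      rw [this, norm_add_sq_real, inner_smul_right, norm_smul, mul_pow, Real.norm_eq_abs, sq_abs,
        ← neg_sub x₀ y, inner_neg_left, norm_neg]
      ring
    rw [h4] at h1
    rw [inner_smul_left]
    simp only [conj_trivial, smul_eq_mul, ← hf] at h1 h2 ⊢
    have h5 : 1 / (2 * s) * (‖y - x₀‖ ^ 2 - 2 * t * ⟪x₀ - y, z - y⟫ + t ^ 2 * ‖z - y‖ ^ 2) =
        1 / (2 * s) * ‖y - x₀‖ ^ 2 - t * (1 / s * ⟪x₀ - y, z - y⟫) +
          t * (t * (1 / (2 * s) * ‖z - y‖ ^ 2)) := by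
      rcases eq_or_ne s 0 with rfl | hs
      · simp
      · field_simp
    rw [h5] at h1
    have h6 : t * (f y + 1 / s * ⟪x₀ - y, z - y⟫) ≤
        t * (f z + t * (1 / (2 * s) * ‖z - y‖ ^ 2)) := by nlinarith
    exact le_of_mul_le_mul_left h6 ht
  have hlim : Tendsto (fun t : ℝ => f z + t * (1 / (2 * s) * ‖z - y‖ ^ 2)) (𝓝[>] 0)
      (𝓝 (f z + 0 * (1 / (2 * s) * ‖z - y‖ ^ 2))) :=
    (Continuous.tendsto (by fun_prop) 0).mono_left nhdsWithin_le_nhds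
  rw [zero_mul, add_zero] at hlim
  refine ge_of_tendsto hlim ?_
  filter_upwards [Ioc_mem_nhdsGT (zero_lt_one' ℝ)] with t ht
  exact key t ht.1 ht.2

lemma proxPoint_inner_nonpos (hh : ConvexOn ℝ univ h) (hlam : 0 < lam) {s : ℝ} (hs : 0 < s)
    {x₀ y z : Vec p} (hy : y ∈ proxPoint h A b lam s x₀) (hz : z ∈ solutions h A b lam) :
    ⟪x₀ - y, z - y⟫ ≤ 0 := by
  have h1 := proxPoint_inequality hh hlam hy z
  have h2 := hz y
  rw [inner_smul_left] at h1
  simp only [conj_trivial] at h1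
  by_contra! h3
  have : 0 < 1 / s * ⟪x₀ - y, z - y⟫ := by positivity
  linarith

/-- Firm nonexpansiveness of the proximal map relative to its fixed points, the solutions. -/
lemma proxPoint_fejer (hh : ConvexOn ℝ univ h) (hlam : 0 < lam) {s : ℝ} (hs : 0 < s)
    {x₀ y z : Vec p} (hy : y ∈ proxPoint h A b lam s x₀) (hz : z ∈ solutions h A b lam) :
    ‖y - z‖ ^ 2 + ‖x₀ - y‖ ^ 2 ≤ ‖x₀ - z‖ ^ 2 := by
  have h1 := proxPoint_inner_nonpos hh hlam hs hy hz
  have h2 : x₀ - z = (x₀ - y) - (z - y) := by abel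
  rw [h2, norm_sub_sq_real (x₀ - y), norm_sub_rev y z]
  linarith

/-- A proximal point is the primal part of a zero of `S`. -/
lemma proxPoint_exists_kkt (hh : ConvexOn ℝ univ h) (hlam : 0 < lam) {s : ℝ}
    {x₀ y : Vec p} (hy : y ∈ proxPoint h A b lam s x₀) :
    ∃ α, triple ((1 / s) • (x₀ - y)) 0 0 ∈ kkt h A b lam (triple y (b - A y) α) := by
  obtain ⟨v, hv, g, hg, e⟩ := exists_multiplier hh hlam _ y (proxPoint_inequality hh hlam hy)
  exact ⟨v, mem_kkt_iff.2 ⟨⟨g, hg, e⟩, by rwa [add_zero], sub_self _⟩⟩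

end Kkt

/-! ### Quasi-Fejér sequences -/

lemma exists_tendsto_of_le_add {a e : ℕ → ℝ} (ha : ∀ k, 0 ≤ a k) (he : Summable e)
    (h : ∀ k, a (k + 1) ≤ a k + e k) : ∃ l, Tendsto a atTop (𝓝 l) := by
  have hs := he.hasSum.tendsto_sum_nat
  have hanti : Antitone (fun k => a k - ∑ j ∈ Finset.range k, e j) := by
    refine antitone_nat_of_succ_le fun k => ?_
    rw [Finset.sum_range_succ]
    linarith [h k]
  obtain ⟨B, hB⟩ := hs.bddAbove_range
  have hbdd : BddBelow (range fun k => a k - ∑ j ∈ Finset.range k, e j) := by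
    refine ⟨-B, ?_⟩
    rintro _ ⟨k, rfl⟩
    have := hB (mem_range_self k)
    simp only at this ⊢
    linarith [ha k]
  have := (tendsto_atTop_ciInf hanti hbdd).add hs
  exact ⟨_, by simpa using this⟩

/-- Quasi-Fejér monotonicity with a multiplicative error: `log (1 + a)` has summable increments. -/
lemma exists_tendsto_of_le_mul {a g : ℕ → ℝ} (ha : ∀ k, 0 ≤ a k) (hg0 : ∀ k, 0 ≤ g k)
    (hg : Summable g) (h : ∀ᶠ k in atTop, a (k + 1) ≤ a k + g k * (1 + a (k + 1))) :
    ∃ l, Tendsto a atTop (𝓝 l) := by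
  have hsmall : ∀ᶠ k in atTop, g k ≤ 1 / 2 :=
    (hg.tendsto_atTop_zero.eventually_lt_const (by norm_num : (0 : ℝ) < 1 / 2)).mono
      fun _ => le_of_lt
  obtain ⟨K, hK⟩ := eventually_atTop.1 (h.and hsmall)
  have hlog : ∀ k, Real.log (1 + a (k + 1 + K)) ≤ Real.log (1 + a (k + K)) + 2 * g (k + K) := by
    intro k
    obtain ⟨h1, h2⟩ := hK (k + K) (by omega)
    have h3 := ha (k + K + 1)
    have h4 := ha (k + K)
    have h5 := hg0 (k + K)
    rw [show k + 1 + K = k + K + 1 by ring]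
    have h6 : 1 + a (k + K + 1) ≤ (1 + a (k + K)) * Real.exp (2 * g (k + K)) := by
      have h7 : 1 + a (k + K + 1) ≤ (1 + a (k + K)) * (2 * g (k + K) + 1) := by
        nlinarith [mul_nonneg h5 h4, mul_nonneg h5 h3, mul_nonneg h5 h5]
      exact h7.trans (mul_le_mul_of_nonneg_left (Real.add_one_le_exp _) (by positivity))
    calc Real.log (1 + a (k + K + 1))
        ≤ Real.log ((1 + a (k + K)) * Real.exp (2 * g (k + K))) :=
          Real.log_le_log (by positivity) h6
      _ = _ := by rw [Real.log_mul (by positivity) (Real.exp_pos _).ne', Real.log_exp]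
  obtain ⟨l, hl⟩ := exists_tendsto_of_le_add (a := fun k => Real.log (1 + a (k + K)))
    (fun k => Real.log_nonneg (by linarith [ha (k + K)]))
    (((summable_nat_add_iff K).2 hg).mul_left 2) hlog
  refine ⟨Real.exp l - 1, (tendsto_add_atTop_iff_nat K).1 ?_⟩
  have := ((Real.continuous_exp.tendsto l).comp hl).sub_const 1
  refine this.congr fun k => ?_
  simp only [Function.comp_apply]
  rw [Real.exp_log (by linarith [ha (k + K)])]
  ring

/-- Opial's lemma in finite dimension. -/
lemma exists_tendsto_of_fejer {d : ℕ} {S : Set (Vec d)} (hS : S.Nonempty) {x : ℕ → Vec d}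
    (h1 : ∀ z ∈ S, ∃ l, Tendsto (fun k => ‖x k - z‖) atTop (𝓝 l))
    (h2 : ∀ (φ : ℕ → ℕ) (z : Vec d), StrictMono φ → Tendsto (x ∘ φ) atTop (𝓝 z) → z ∈ S) :
    ∃ z ∈ S, Tendsto x atTop (𝓝 z) := by
  obtain ⟨z₀, hz₀⟩ := hS
  obtain ⟨l, hl⟩ := h1 z₀ hz₀
  obtain ⟨B, hB⟩ := hl.bddAbove_range
  have hmem : ∀ k, x k ∈ Metric.closedBall z₀ B := fun k => by
    rw [mem_closedBall_iff_norm]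
    exact hB (mem_range_self k)
  obtain ⟨z, -, φ, hφ, hz⟩ := tendsto_subseq_of_bounded Metric.isBounded_closedBall hmem
  have hzS := h2 φ z hφ hz
  obtain ⟨l', hl'⟩ := h1 z hzS
  have h0 : Tendsto (fun k => ‖x (φ k) - z‖) atTop (𝓝 0) := tendsto_iff_norm_sub_tendsto_zero.1 hz
  have hl0 : l' = 0 := tendsto_nhds_unique (hl'.comp hφ.tendsto_atTop) h0
  rw [hl0] at hl'
  exact ⟨z, hzS, tendsto_iff_norm_sub_tendsto_zero.2 hl'⟩

/-! ### Convergence of the inexact proximal point algorithm -/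

section Convergence

variable {p n : ℕ} {h : Vec n → ℝ} {A : Vec p →L[ℝ] Vec n} {b : Vec n} {lam : ℝ}
  {σ : ℕ → ℝ} {x : ℕ → Vec p}

lemma critA_converges (hh : ConvexOn ℝ univ h) (hlam : 0 < lam)
    (hsol : (solutions h A b lam).Nonempty) (hσ : ∀ k, 0 < σ k) (hmono : Monotone σ)
    (hA : CritA h A b lam σ x) :
    ∃ z ∈ solutions h A b lam, Tendsto x atTop (𝓝 z) := by
  obtain ⟨ε, hε0, hε, H⟩ := hA
  choose y hy hxy using H
  have hconv : ∀ z ∈ solutions h A b lam, ∃ l, Tendsto (fun k => ‖x k - z‖) atTop (𝓝 l) := by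
    intro z hz
    refine exists_tendsto_of_le_add (fun _ => norm_nonneg _) hε fun k => ?_
    have h1 := proxPoint_fejer hh hlam (hσ k) (hy k) hz
    have h2 : ‖y k - z‖ ≤ ‖x k - z‖ :=
      le_of_sq_le_sq (by nlinarith [sq_nonneg ‖x k - y k‖]) (norm_nonneg _)
    have h3 := norm_sub_le_norm_sub_add_norm_sub (x (k + 1)) (y k) z
    linarith [hxy k]
  refine exists_tendsto_of_fejer hsol hconv fun φ z hφ hz => ?_
  obtain ⟨s, hs⟩ := hsol
  obtain ⟨l, hl⟩ := hconv s hs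
  have hl1 : Tendsto (fun k => ‖x (k + 1) - s‖) atTop (𝓝 l) := hl.comp (tendsto_add_atTop_nat 1)
  have hε' := hε.tendsto_atTop_zero
  have hys : Tendsto (fun k => ‖y k - s‖) atTop (𝓝 l) := by
    refine tendsto_of_tendsto_of_tendsto_of_le_of_le (g := fun k => ‖x (k + 1) - s‖ - ε k)
      (by simpa using hl1.sub hε') hl (fun k => ?_) (fun k => ?_)
    · have h3 := norm_sub_le_norm_sub_add_norm_sub (x (k + 1)) (y k) s
      simp only
      linarith [hxy k]
    · have h1 := proxPoint_fejer hh hlam (hσ k) (hy k) hs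
      exact le_of_sq_le_sq (by nlinarith [sq_nonneg ‖x k - y k‖]) (norm_nonneg _)
  have hQ : Tendsto (fun k => ‖x k - y k‖) atTop (𝓝 0) := by
    have h1 : Tendsto (fun k => ‖x k - s‖ ^ 2 - ‖y k - s‖ ^ 2) atTop (𝓝 0) := by
      simpa using (hl.pow 2).sub (hys.pow 2)
    have h2 : Tendsto (fun k => ‖x k - y k‖ ^ 2) atTop (𝓝 0) :=
      squeeze_zero (fun _ => sq_nonneg _)
        (fun k => by linarith [proxPoint_fejer hh hlam (hσ k) (hy k) hs]) h1
    simpa using h2.sqrt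
  have hQφ : Tendsto (fun k => x (φ k) - y (φ k)) atTop (𝓝 0) :=
    tendsto_zero_iff_norm_tendsto_zero.2 (hQ.comp hφ.tendsto_atTop)
  have hyφ : Tendsto (fun k => y (φ k)) atTop (𝓝 z) := by simpa using hz.sub hQφ
  have hc : Tendsto (fun k => (1 / σ (φ k)) • (x (φ k) - y (φ k))) atTop (𝓝 0) := by
    rw [tendsto_zero_iff_norm_tendsto_zero] at hQφ ⊢
    refine squeeze_zero (fun _ => norm_nonneg _) (fun k => ?_)
      (by simpa using hQφ.const_mul (1 / σ 0))
    rw [norm_smul, Real.norm_of_nonneg (by have := hσ (φ k); positivity)]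
    gcongr
    rw [one_div]
    exact inv_anti₀ (hσ 0) (hmono (Nat.zero_le _))
  intro w
  have hobj := (continuous_objective (A := A) (b := b) (lam := lam) hh).tendsto z
  have h1 := (hobj.comp hyφ).add (hc.inner (hyφ.const_sub w))
  rw [inner_zero_left, add_zero] at h1
  exact le_of_tendsto h1 (Eventually.of_forall fun k =>
    proxPoint_inequality hh hlam (hy (φ k)) w)

/-- The basic inequality of the inexact step `(A')`, relative to a zero `(z, b - A z, β)` of `T`.
Only the values of `h` near the fixed point `b - A z` enter, so the bound does not depend on the
size of `α`. -/
lemma inexact_step_inequality (hlam : 0 < lam) {s : ℝ} (hs : 0 < s) {y x w1 z : Vec p}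
    {u α w2 w3 β : Vec n} (hz : 0 ∈ kkt h A b lam (triple z (b - A z) β))
    (hw : triple (w1 - (1 / s) • (x - y)) w2 w3 ∈ kkt h A b lam (triple x u α)) :
    ⟪x - y, x - z⟫ ≤ s * (h (b - A z - w3) - h (b - A z) + ⟪β, w3⟫ +
      ⟪w1 - ContinuousLinearMap.adjoint A w2, x - z⟫) := by
  obtain ⟨⟨g, hg, e⟩, hv, e3⟩ := mem_kkt_iff.1 hw
  obtain ⟨⟨g', hg', e'⟩, hβ, -⟩ := zero_mem_kkt_iff.1 hz
  obtain rfl : u = b - A x - w3 := by rw [← e3]; abel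
  have h1 := shifted_subgradient_le hlam hg hv z
  have h2 := hβ (b - A x - w3)
  have h3 := mul_le_mul_of_nonneg_left (hg' x) hlam.le
  have h4 : b - A x - w3 - (b - A z) = -(A (x - z)) - w3 := by rw [map_sub]; abel
  have h5 : lam * ⟪g', x - z⟫ = ⟪β, A (x - z)⟫ := by
    rw [← ContinuousLinearMap.adjoint_inner_left, ← e', inner_smul_left]; simp
  rw [h4, inner_sub_right, inner_neg_right] at h2
  rw [mul_add, h5] at h3
  have h6 : lam • g - ContinuousLinearMap.adjoint A (α + w2) =
      w1 - ContinuousLinearMap.adjoint A w2 - (1 / s) • (x - y) := by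
    rw [map_add, ← sub_sub, e]; abel
  rw [h6, ← neg_sub x z, inner_neg_right, inner_sub_left, inner_smul_left] at h1
  simp only [conj_trivial] at h1
  have h7 : 1 / s * ⟪x - y, x - z⟫ ≤ h (b - A z - w3) - h (b - A z) + ⟪β, w3⟫ +
      ⟪w1 - ContinuousLinearMap.adjoint A w2, x - z⟫ := by linarith
  rw [one_div, inv_mul_le_iff₀ hs] at h7
  exact h7

lemma exists_local_lipschitz (hh : ConvexOn ℝ univ h) (u : Vec n) :
    ∃ L r : ℝ, 0 ≤ L ∧ 0 < r ∧ ∀ w, ‖w‖ < r → h (u - w) - h u ≤ L * ‖w‖ := by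
  obtain ⟨L, t, ht, hL⟩ := hh.locallyLipschitz u
  obtain ⟨r, hr, hball⟩ := Metric.mem_nhds_iff.1 ht
  refine ⟨L, r, L.2, hr, fun w hw => ?_⟩
  have h1 := hL.dist_le_mul (u - w) (hball (by simpa using hw)) u (mem_of_mem_nhds ht)
  rw [Real.dist_eq, dist_eq_norm, sub_sub_cancel_left, norm_neg] at h1
  exact (le_abs_self _).trans h1

lemma norm_sub_adjoint_le {w1 : Vec p} {w2 : Vec n} {r : ℝ} (h1 : ‖w1‖ ≤ r) (h2 : ‖w2‖ ≤ r) :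
    ‖w1 - ContinuousLinearMap.adjoint A w2‖ ≤ (1 + ‖A‖) * r := by
  refine (norm_sub_le _ _).trans ?_
  have h3 := (ContinuousLinearMap.adjoint A).le_opNorm w2
  rw [LinearIsometryEquiv.norm_map] at h3
  have h4 : ‖A‖ * ‖w2‖ ≤ ‖A‖ * r := by gcongr
  linarith

lemma critA'_converges (hh : ConvexOn ℝ univ h) (hlam : 0 < lam)
    (hsol : (solutions h A b lam).Nonempty) (hσ : ∀ k, 0 < σ k) (hmono : Monotone σ)
    (hA : CritA' h A b lam σ x) :
    ∃ z ∈ solutions h A b lam, Tendsto x atTop (𝓝 z) := by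
  obtain ⟨γ, hγ0, hγ, u, α, H⟩ := hA
  choose w1 w2 w3 hw1 hw2 hw3 hw using fun k =>
    exists_residual hh hlam (σ k) (x k) (x (k + 1)) (u (k + 1)) (α (k + 1)) (H k)
  have hσ0 : ∀ k, σ 0 ≤ σ k := fun k => hmono (Nat.zero_le k)
  have hr : Tendsto (fun k => γ k / σ k) atTop (𝓝 0) := by
    refine squeeze_zero (fun k => div_nonneg (hγ0 k) (hσ k).le) (fun k => ?_)
      (by simpa using hγ.tendsto_atTop_zero.div_const (σ 0))
    exact div_le_div_of_nonneg_left (hγ0 k) (hσ 0) (hσ0 k)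
  have hw3' : Tendsto w3 atTop (𝓝 0) := squeeze_zero_norm hw3 hr
  have hstep : ∀ z ∈ solutions h A b lam, ∃ C : ℝ, 0 ≤ C ∧ ∀ᶠ k in atTop,
      ‖x (k + 1) - z‖ ^ 2 + ‖x (k + 1) - x k‖ ^ 2 ≤
        ‖x k - z‖ ^ 2 + C * γ k * (1 + ‖x (k + 1) - z‖ ^ 2) := by
    intro z hz
    obtain ⟨β, hβ⟩ := exists_zero_mem_kkt hh hlam hz
    obtain ⟨L, r, hL, hr0, hLip⟩ := exists_local_lipschitz hh (b - A z)
    refine ⟨2 * (L + ‖β‖ + (1 + ‖A‖)), by positivity, ?_⟩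
    have hev : ∀ᶠ k in atTop, ‖w3 k‖ < r := by
      have := hw3'.norm
      rw [norm_zero] at this
      exact this.eventually_lt_const hr0
    filter_upwards [hev] with k hk
    have h1 := inexact_step_inequality hlam (hσ k) hβ (hw k)
    have h2 := hLip _ hk
    have h3 : L * ‖w3 k‖ ≤ L * (γ k / σ k) := by gcongr; exact hw3 k
    have h4 : ⟪β, w3 k⟫ ≤ ‖β‖ * (γ k / σ k) :=
      (real_inner_le_norm _ _).trans (by gcongr; exact hw3 k)
    have h5 : ⟪w1 k - ContinuousLinearMap.adjoint A (w2 k), x (k + 1) - z⟫ ≤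
        (1 + ‖A‖) * (γ k / σ k) * ‖x (k + 1) - z‖ :=
      (real_inner_le_norm _ _).trans (by gcongr; exact norm_sub_adjoint_le (hw1 k) (hw2 k))
    have h6 : ⟪x (k + 1) - x k, x (k + 1) - z⟫ ≤
        σ k * ((L + ‖β‖) * (γ k / σ k) + (1 + ‖A‖) * (γ k / σ k) * ‖x (k + 1) - z‖) :=
      h1.trans (mul_le_mul_of_nonneg_left (by linarith) (hσ k).le)
    have h7 : σ k * ((L + ‖β‖) * (γ k / σ k) + (1 + ‖A‖) * (γ k / σ k) * ‖x (k + 1) - z‖) =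
        γ k * ((L + ‖β‖) + (1 + ‖A‖) * ‖x (k + 1) - z‖) := by
      have := (hσ k).ne'
      field_simp
    rw [h7] at h6
    have h8 : ‖x k - z‖ ^ 2 = ‖x (k + 1) - z‖ ^ 2 - 2 * ⟪x (k + 1) - x k, x (k + 1) - z⟫ +
        ‖x (k + 1) - x k‖ ^ 2 := by
      have : x k - z = (x (k + 1) - z) - (x (k + 1) - x k) := by abel
      rw [this, norm_sub_sq_real, real_inner_comm]
    have h9 : (L + ‖β‖) + (1 + ‖A‖) * ‖x (k + 1) - z‖ ≤
        (L + ‖β‖ + (1 + ‖A‖)) * (1 + ‖x (k + 1) - z‖ ^ 2) := by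
      have h10 : ‖x (k + 1) - z‖ ≤ 1 + ‖x (k + 1) - z‖ ^ 2 := by
        nlinarith [sq_nonneg (‖x (k + 1) - z‖ - 1), norm_nonneg (x (k + 1) - z)]
      have h11 : (1 + ‖A‖) * ‖x (k + 1) - z‖ ≤ (1 + ‖A‖) * (1 + ‖x (k + 1) - z‖ ^ 2) := by gcongr
      have h12 : 0 ≤ (L + ‖β‖) * ‖x (k + 1) - z‖ ^ 2 := by positivity
      linarith
    have h13 := mul_le_mul_of_nonneg_left h9 (hγ0 k)
    linarith
  have hsq : ∀ z ∈ solutions h A b lam, ∃ l, Tendsto (fun k => ‖x k - z‖ ^ 2) atTop (𝓝 l) := by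
    intro z hz
    obtain ⟨C, hC, hev⟩ := hstep z hz
    refine exists_tendsto_of_le_mul (fun _ => sq_nonneg _)
      (fun k => mul_nonneg hC (hγ0 k)) (hγ.mul_left C) ?_
    filter_upwards [hev] with k hk
    linarith [sq_nonneg ‖x (k + 1) - x k‖]
  have hD : Tendsto (fun k => x (k + 1) - x k) atTop (𝓝 0) := by
    obtain ⟨z, hz⟩ := hsol
    obtain ⟨C, hC, hev⟩ := hstep z hz
    obtain ⟨l, hl⟩ := hsq z hz
    have hl1 : Tendsto (fun k => ‖x (k + 1) - z‖ ^ 2) atTop (𝓝 l) :=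
      hl.comp (tendsto_add_atTop_nat 1)
    have h1 : Tendsto (fun k => ‖x k - z‖ ^ 2 - ‖x (k + 1) - z‖ ^ 2 +
        C * γ k * (1 + ‖x (k + 1) - z‖ ^ 2)) atTop (𝓝 0) := by
      have := (hl.sub hl1).add
        ((hγ.tendsto_atTop_zero.const_mul C).mul (hl1.const_add 1))
      simpa using this
    have h2 : Tendsto (fun k => ‖x (k + 1) - x k‖ ^ 2) atTop (𝓝 0) :=
      squeeze_zero' (Eventually.of_forall fun _ => sq_nonneg _)
        (hev.mono fun k hk => by linarith) h1
    rw [tendsto_zero_iff_norm_tendsto_zero]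
    simpa using h2.sqrt
  refine exists_tendsto_of_fejer hsol (fun z hz => ?_) fun φ z hφ hz y => ?_
  · obtain ⟨l, hl⟩ := hsq z hz
    exact ⟨√l, by simpa using hl.sqrt⟩
  -- The shifted subgradient inequalities pass to the limit along the subsequence.
  have hφt := hφ.tendsto_atTop
  have hx1 : Tendsto (fun k => x (φ k + 1)) atTop (𝓝 z) := by
    simpa using hz.add (hD.comp hφt)
  have hw3φ : Tendsto (fun k => w3 (φ k)) atTop (𝓝 0) := hw3'.comp hφt
  have hq : Tendsto (fun k => w1 (φ k) - ContinuousLinearMap.adjoint A (w2 (φ k)) -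
      (1 / σ (φ k)) • (x (φ k + 1) - x (φ k))) atTop (𝓝 0) := by
    have h1 : Tendsto (fun k => w1 k - ContinuousLinearMap.adjoint A (w2 k)) atTop (𝓝 0) :=
      squeeze_zero_norm (fun k => norm_sub_adjoint_le (hw1 k) (hw2 k))
        (by simpa using hr.const_mul (1 + ‖A‖))
    have h2 : Tendsto (fun k => (1 / σ k) • (x (k + 1) - x k)) atTop (𝓝 0) := by
      rw [tendsto_zero_iff_norm_tendsto_zero] at hD
      refine squeeze_zero_norm (fun k => ?_) (by simpa using hD.const_mul (1 / σ 0))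
      rw [norm_smul, Real.norm_of_nonneg (by have := hσ k; positivity)]
      gcongr
      rw [one_div]
      exact inv_anti₀ (hσ 0) (hσ0 k)
    rw [← sub_zero (0 : Vec p)]
    exact (h1.sub h2).comp hφt
  have hcont := hh.locallyLipschitz.continuous
  have hl1 := continuous_l1 (d := p)
  have hA1 : Tendsto (fun k => b - A (x (φ k + 1)) - w3 (φ k)) atTop (𝓝 (b - A z)) := by
    simpa using (((A.continuous.tendsto z).comp hx1).const_sub b).sub hw3φ
  have hA2 : Tendsto (fun k => b - A y - w3 (φ k)) atTop (𝓝 (b - A y)) := by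
    simpa using hw3φ.const_sub (b - A y)
  have hlhs := (((hcont.tendsto _).comp hA1).add
    (((hl1.tendsto _).comp hx1).const_mul lam)).add (hq.inner (hx1.const_sub y))
  have hrhs := ((hcont.tendsto _).comp hA2).add_const (lam * l1 y)
  rw [inner_zero_left, add_zero] at hlhs
  refine le_of_tendsto_of_tendsto' hlhs hrhs fun k => ?_
  obtain ⟨⟨g, hg, e⟩, hv, e3⟩ := mem_kkt_iff.1 (hw (φ k))
  have hu : u (φ k + 1) = b - A (x (φ k + 1)) - w3 (φ k) := by rw [← e3]; abel
  rw [hu] at hv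
  have h1 := shifted_subgradient_le hlam hg hv y
  have h6 : lam • g - ContinuousLinearMap.adjoint A (α (φ k + 1) + w2 (φ k)) =
      w1 (φ k) - ContinuousLinearMap.adjoint A (w2 (φ k)) -
        (1 / σ (φ k)) • (x (φ k + 1) - x (φ k)) := by
    rw [map_add, ← sub_sub, e]; abel
  rw [h6] at h1
  exact h1

end Convergence

/-! ### Polyhedral functions -/

section Polyhedral

variable {d : ℕ}

lemma isPolyhedral_of_fintype {ι : Type*} [Fintype ι] [Nonempty ι] {F : Vec d → ℝ}
    (a : ι → Vec d) (c : ι → ℝ) (hF : ∀ u, F u = ⨆ i, (⟪a i, u⟫ + c i)) : IsPolyhedral F := by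
  obtain ⟨m, hm⟩ := Nat.exists_eq_succ_of_ne_zero (Fintype.card_ne_zero (α := ι))
  let φ : ι ≃ Fin (m + 1) := Fintype.equivFinOfCardEq hm
  refine ⟨m, a ∘ φ.symm, c ∘ φ.symm, fun u => ?_⟩
  rw [hF]
  exact (φ.symm.iSup_comp (g := fun i => ⟪a i, u⟫ + c i)).symm

lemma sum_abs_eq_iSup {ι : Type*} [Fintype ι] (t : ι → ℝ) :
    ∑ i, |t i| = ⨆ s : ι → Bool, ∑ i, (if s i then (1 : ℝ) else -1) * t i := by
  refine le_antisymm ?_ (ciSup_le fun s => Finset.sum_le_sum fun i _ => ?_)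
  · refine le_trans (le_of_eq ?_)
      (le_ciSup (Set.finite_range _).bddAbove (fun i => decide (0 ≤ t i)))
    refine Finset.sum_congr rfl fun i _ => ?_
    by_cases h : 0 ≤ t i
    · simp [h, abs_of_nonneg h]
    · simp [h, abs_of_neg (not_le.1 h)]
  · split_ifs
    · simpa using le_abs_self _
    · simpa using neg_le_abs _

lemma isPolyhedral_l1 : IsPolyhedral (l1 : Vec d → ℝ) := by
  refine isPolyhedral_of_fintype (ι := Fin d → Bool)
    (fun s => WithLp.toLp 2 fun i => if s i then (1 : ℝ) else -1) (fun _ => 0) fun u => ?_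
  rw [l1, sum_abs_eq_iSup]
  refine iSup_congr fun s => ?_
  rw [PiLp.inner_apply, add_zero]
  exact Finset.sum_congr rfl fun i _ => by simp [mul_comm]

/-- For `n ≤ 1` the coefficient is `2 / 0 = 0`. -/
lemma rankLoss_coeff_nonneg (n : ℕ) : 0 ≤ 2 / ((n : ℝ) * ((n : ℝ) - 1)) := by
  rcases n with _ | n
  · simp
  · rw [Nat.cast_succ, add_sub_cancel_right]; positivity

lemma isPolyhedral_rankLoss (n : ℕ) : IsPolyhedral (rankLoss n) := by
  have hk := rankLoss_coeff_nonneg n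
  set k := 2 / ((n : ℝ) * ((n : ℝ) - 1)) with hkdef
  let e : Fin n → Vec n := fun i => EuclideanSpace.single i (1 : ℝ)
  let t : Vec n → Fin n × Fin n → ℝ := fun u q => if q.1 < q.2 then k * (u q.1 - u q.2) else 0
  let w : Fin n × Fin n → Vec n := fun q => if q.1 < q.2 then k • (e q.1 - e q.2) else 0
  have hw : ∀ u q, ⟪w q, u⟫ = t u q := by
    intro u q
    simp only [w, t]
    split_ifs
    · simp [e, inner_smul_left, inner_sub_left, EuclideanSpace.inner_single_left]
    · simp
  refine isPolyhedral_of_fintype (ι := Fin n × Fin n → Bool)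
    (fun s => ∑ q, (if s q then (1 : ℝ) else -1) • w q) (fun _ => 0) fun u => ?_
  have h1 : rankLoss n u = ∑ q, |t u q| := by
    rw [rankLoss, ← hkdef, Finset.mul_sum, Fintype.sum_prod_type]
    refine Finset.sum_congr rfl fun i _ => ?_
    rw [Finset.mul_sum, Finset.sum_filter]
    refine Finset.sum_congr rfl fun j _ => ?_
    simp only [t]
    split_ifs
    · rw [abs_mul, abs_of_nonneg hk]
    · simp
  rw [h1, sum_abs_eq_iSup]
  refine iSup_congr fun s => ?_
  rw [sum_inner, add_zero]
  exact Finset.sum_congr rfl fun q _ => by rw [inner_smul_left, hw]; simp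

variable {m : ℕ} {a : Fin (m + 1) → Vec d} {c : Fin (m + 1) → ℝ}

lemma le_of_eq_iSup {F : Vec d → ℝ} (hF : ∀ u, F u = ⨆ i, (⟪a i, u⟫ + c i)) (i : Fin (m + 1))
    (u : Vec d) : ⟪a i, u⟫ + c i ≤ F u := by
  rw [hF]
  exact le_ciSup (f := fun i => ⟪a i, u⟫ + c i) (Set.finite_range _).bddAbove i

/-- The part of the graph of the subdifferential of `u ↦ max_i (⟪a i, u⟫ + c i)` on which all the
affine functions in `I` are active: the pairs `(u, τ)`, with `τ` the weights of a subgradient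
`∑ i, τ i • a i` in the convex hull of the gradients from `I`. -/
def graphPiece (a : Fin (m + 1) → Vec d) (c : Fin (m + 1) → ℝ) (I : Set (Fin (m + 1))) :
    Set (Vec d × (Fin (m + 1) → ℝ)) :=
  {q | (∀ i, 0 ≤ q.2 i) ∧ ∑ i, q.2 i = 1 ∧ (∀ i ∉ I, q.2 i ≤ 0) ∧
    ∀ i ∈ I, ∀ j, ⟪a j, q.1⟫ + c j ≤ ⟪a i, q.1⟫ + c i}

lemma isPolyhedron_graphPiece (I : Set (Fin (m + 1))) : IsPolyhedron (graphPiece a c I) := by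
  classical
  let τ : Fin (m + 1) → (Vec d × (Fin (m + 1) → ℝ)) →L[ℝ] ℝ := fun i =>
    (ContinuousLinearMap.proj i).comp (ContinuousLinearMap.snd ℝ (Vec d) (Fin (m + 1) → ℝ))
  let α : Fin (m + 1) → (Vec d × (Fin (m + 1) → ℝ)) →L[ℝ] ℝ := fun i =>
    (innerSL ℝ (a i)).comp (ContinuousLinearMap.fst ℝ (Vec d) (Fin (m + 1) → ℝ))
  have h1 := IsPolyhedron.iInter fun i => isPolyhedron_le (-τ i) 0
  have h2 := (isPolyhedron_le (∑ i, τ i) 1).inter (isPolyhedron_le (-∑ i, τ i) (-1))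
  have h3 := IsPolyhedron.iInter fun i =>
    show IsPolyhedron (if i ∈ I then univ else {e | τ i e ≤ 0})
    by split_ifs; exacts [isPolyhedron_univ, isPolyhedron_le _ _]
  have h4 := IsPolyhedron.iInter fun i => IsPolyhedron.iInter fun j =>
    show IsPolyhedron (if i ∈ I then {e | (α j - α i) e ≤ c i - c j} else univ)
    by split_ifs; exacts [isPolyhedron_le _ _, isPolyhedron_univ]
  convert h1.inter (h2.inter (h3.inter h4)) using 1
  ext q
  simp only [graphPiece, mem_ofPred_eq, mem_inter_iff, mem_iInter]
  refine and_congr (forall_congr' fun i => ?_) (and_congr ?_ (and_congr (forall_congr' fun i => ?_)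
    (forall_congr' fun i => ?_)))
  · simp [τ]
  · have : (∑ i, τ i) q = ∑ i, q.2 i := by simp [τ]
    rw [neg_apply, this, neg_le_neg_iff, le_antisymm_iff]
  · by_cases hi : i ∈ I <;> simp [hi, τ]
  · by_cases hi : i ∈ I
    · simp only [hi, true_imp_iff, if_true, mem_ofPred_eq]
      refine forall_congr' fun j => ?_
      have h5 : (α j - α i) q = ⟪a j, q.1⟫ - ⟪a i, q.1⟫ := by simp [α]
      rw [h5]
      constructor <;> intro h <;> linarith
    · simp [hi]

/-- The weights of any point of a piece give a subgradient at every other point of the piece. -/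
lemma sum_smul_mem_subdiff {F : Vec d → ℝ} (hF : ∀ u, F u = ⨆ i, (⟪a i, u⟫ + c i))
    {I : Set (Fin (m + 1))} {u u' : Vec d} {τ τ' : Fin (m + 1) → ℝ}
    (hq : (u, τ) ∈ graphPiece a c I) (hq' : (u', τ') ∈ graphPiece a c I) :
    ∑ i, τ' i • a i ∈ subdiff F u := by
  obtain ⟨-, -, -, hact⟩ := hq
  obtain ⟨h0, h1, hI, -⟩ := hq'
  simp only at hact h0 h1 hI
  have hval : ∀ i, τ' i * F u = τ' i * (⟪a i, u⟫ + c i) := by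
    intro i
    by_cases hi : i ∈ I
    · rw [hF]
      congr 1
      exact le_antisymm (ciSup_le (hact i hi))
        (le_ciSup (f := fun i => ⟪a i, u⟫ + c i) (Set.finite_range _).bddAbove i)
    · rw [le_antisymm (hI i hi) (h0 i), zero_mul, zero_mul]
  intro y
  calc F u + ⟪∑ i, τ' i • a i, y - u⟫
      = ∑ i, τ' i * F u + ∑ i, τ' i * (⟪a i, y⟫ - ⟪a i, u⟫) := by
        rw [← Finset.sum_mul, h1, one_mul, sum_inner]
        congr 1
        exact Finset.sum_congr rfl fun i _ => by
          rw [inner_smul_left, inner_sub_right]; simp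
    _ = ∑ i, τ' i * (⟪a i, y⟫ + c i) := by
        rw [← Finset.sum_add_distrib]
        exact Finset.sum_congr rfl fun i _ => by rw [hval]; ring
    _ ≤ ∑ i, τ' i * F y := Finset.sum_le_sum fun i _ =>
        mul_le_mul_of_nonneg_left (le_of_eq_iSup hF i y) (h0 i)
    _ = F y := by rw [← Finset.sum_mul, h1, one_mul]

/-- A subgradient of a polyhedral function is a convex combination of the active gradients:
otherwise a separating direction would violate the subgradient inequality for small steps. -/
lemma exists_weights_of_mem_subdiff {F : Vec d → ℝ} (hF : ∀ u, F u = ⨆ i, (⟪a i, u⟫ + c i))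
    {u v : Vec d} (hv : v ∈ subdiff F u) :
    ∃ I τ, (u, τ) ∈ graphPiece a c I ∧ ∑ i, τ i • a i = v := by
  classical
  set I : Set (Fin (m + 1)) := {i | ∀ j, ⟪a j, u⟫ + c j ≤ ⟪a i, u⟫ + c i} with hI
  let L : (Fin (m + 1) → ℝ) →L[ℝ] Vec d := ∑ i, (ContinuousLinearMap.proj i).smulRight (a i)
  have hL : ∀ τ, L τ = ∑ i, τ i • a i := fun τ => by simp [L]
  let W : Set (Fin (m + 1) → ℝ) := stdSimplex ℝ (Fin (m + 1)) ∩ {τ | ∀ i ∉ I, τ i = 0}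
  suffices hmem : v ∈ L '' W by
    obtain ⟨τ, ⟨⟨h0, h1⟩, h2⟩, e⟩ := hmem
    exact ⟨I, τ, ⟨h0, h1, fun i hi => (h2 i hi).le, fun i hi => hi⟩, by rw [← hL, e]⟩
  have hWc : IsCompact W := by
    refine (isCompact_stdSimplex ℝ _).inter_right ?_
    rw [show {τ : Fin (m + 1) → ℝ | ∀ i ∉ I, τ i = 0} = ⋂ i, ⋂ (_ : i ∉ I), {τ | τ i = 0} by
      ext; simp]
    exact isClosed_iInter fun i => isClosed_iInter fun _ =>
      isClosed_eq (continuous_apply i) continuous_const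
  have hWconv : Convex ℝ W := by
    refine (convex_stdSimplex ℝ _).inter ?_
    intro x hx y hy s t _ _ _ i hi
    simp [hx i hi, hy i hi]
  by_contra hnot
  obtain ⟨f, r, hf1, hf2⟩ := geometric_hahn_banach_closed_point
    (hWconv.linear_image (L : (Fin (m + 1) → ℝ) →ₗ[ℝ] Vec d))
    (hWc.image L.continuous).isClosed hnot
  set e : Vec d := (InnerProductSpace.toDual ℝ (Vec d)).symm f with he
  have hfe : ∀ y, f y = ⟪y, e⟫ := fun y => by
    rw [real_inner_comm, he, InnerProductSpace.toDual_symm_apply]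
  have hactive : ∀ i ∈ I, ⟪a i, e⟫ < ⟪v, e⟫ := by
    intro i hi
    rw [← hfe, ← hfe]
    refine (hf1 _ ⟨Pi.single i 1, ⟨single_mem_stdSimplex ℝ i, fun j hj => ?_⟩, ?_⟩).trans hf2
    · rw [Pi.single_eq_of_ne]
      rintro rfl
      exact hj hi
    · change L (Pi.single i 1) = a i
      rw [hL, Finset.sum_eq_single i]
      · simp
      · intro j _ hj; simp [Pi.single_eq_of_ne hj]
      · simp
  have hev : ∀ᶠ t in 𝓝[>] (0 : ℝ), ∀ i, ⟪a i, u + t • e⟫ + c i < F u + t * ⟪v, e⟫ := by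
    rw [eventually_all]
    intro i
    by_cases hi : i ∈ I
    · filter_upwards [self_mem_nhdsWithin] with t ht
      have h1 := mul_lt_mul_of_pos_left (hactive i hi) (show 0 < t from ht)
      have h2 := le_of_eq_iSup hF i u
      rw [inner_add_right, inner_smul_right]
      linarith
    · obtain ⟨j, hj⟩ : ∃ j, ⟪a i, u⟫ + c i < ⟪a j, u⟫ + c j := by
        simpa [hI] using hi
      have h2 := le_of_eq_iSup hF j u
      have hcont : Continuous fun t : ℝ => F u + t * ⟪v, e⟫ - (⟪a i, u + t • e⟫ + c i) := by
        fun_prop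
      have h3 := (hcont.tendsto 0).eventually_const_lt (u := 0) (by simp; linarith)
      filter_upwards [nhdsWithin_le_nhds h3] with t ht
      linarith
  obtain ⟨t, ht⟩ := hev.exists
  obtain ⟨i, hi⟩ := exists_eq_ciSup_of_finite (f := fun i => ⟪a i, u + t • e⟫ + c i)
  have h1 := hv (u + t • e)
  rw [hF (u + t • e), ← hi, add_sub_cancel_left, inner_smul_right] at h1
  linarith [ht i]

end Polyhedral

/-! ### The error bound in the polyhedral case -/

section UpperLipschitz

variable {p n : ℕ} {h : Vec n → ℝ} {A : Vec p →L[ℝ] Vec n} {b : Vec n} {lam : ℝ}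

/-- Hoffman's bound on one polyhedral piece of the graph of `T`. -/
lemma exists_hoffman_graphPiece {m m' : ℕ} (a : Fin (m + 1) → Vec n) (c : Fin (m + 1) → ℝ)
    (a' : Fin (m' + 1) → Vec p) (c' : Fin (m' + 1) → ℝ) (A : Vec p →L[ℝ] Vec n) (b : Vec n)
    (lam : ℝ) (J : Set (Fin (m' + 1))) (I : Set (Fin (m + 1))) :
    ∃ K ε : ℝ, 0 ≤ K ∧ 0 < ε ∧ ∀ x ρ u τ α, (x, ρ) ∈ graphPiece a' c' J →
      (u, τ) ∈ graphPiece a c I → ∀ w1 w2 w3,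
      lam • ∑ i, ρ i • a' i - ContinuousLinearMap.adjoint A α = w1 → ∑ i, τ i • a i - α = w2 →
      b - A x - u = w3 → ‖triple w1 w2 w3‖ < ε →
      ∃ x' ρ' u' τ' α', (x', ρ') ∈ graphPiece a' c' J ∧ (u', τ') ∈ graphPiece a c I ∧
        lam • ∑ i, ρ' i • a' i - ContinuousLinearMap.adjoint A α' = 0 ∧
        ∑ i, τ' i • a i - α' = 0 ∧ b - A x' - u' = 0 ∧
        ‖triple x u α - triple x' u' α'‖ ≤ K * ‖triple w1 w2 w3‖ := by
  let E := (Vec p × (Fin (m' + 1) → ℝ)) × (Vec n × (Fin (m + 1) → ℝ)) × Vec n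
  let π1 : E →L[ℝ] Vec p × (Fin (m' + 1) → ℝ) := ContinuousLinearMap.fst ℝ _ _
  let π2 : E →L[ℝ] Vec n × (Fin (m + 1) → ℝ) :=
    (ContinuousLinearMap.fst ℝ _ _).comp (ContinuousLinearMap.snd ℝ _ _)
  let π3 : E →L[ℝ] Vec n := (ContinuousLinearMap.snd ℝ _ _).comp (ContinuousLinearMap.snd ℝ _ _)
  let L : (Fin (m + 1) → ℝ) →L[ℝ] Vec n := ∑ i, (ContinuousLinearMap.proj i).smulRight (a i)
  let L' : (Fin (m' + 1) → ℝ) →L[ℝ] Vec p := ∑ i, (ContinuousLinearMap.proj i).smulRight (a' i)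
  have hL : ∀ τ, L τ = ∑ i, τ i • a i := fun τ => by simp [L]
  have hL' : ∀ τ, L' τ = ∑ i, τ i • a' i := fun τ => by simp [L']
  let B1 : E →L[ℝ] Vec p := lam • (L'.comp ((ContinuousLinearMap.snd ℝ _ _).comp π1)) -
    (ContinuousLinearMap.adjoint A : Vec n →L[ℝ] Vec p).comp π3
  let B2 : E →L[ℝ] Vec n := L.comp ((ContinuousLinearMap.snd ℝ _ _).comp π2) - π3
  let B3 : E →L[ℝ] Vec n := -(A.comp ((ContinuousLinearMap.fst ℝ _ _).comp π1)) -
    (ContinuousLinearMap.fst ℝ _ _).comp π2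
  let B : E →L[ℝ] Vec p × Vec n × Vec n := B1.prod (B2.prod B3)
  have hB : ∀ x ρ u τ α, B ((x, ρ), (u, τ), α) =
      (lam • L' ρ - ContinuousLinearMap.adjoint A α, L τ - α, -A x - u) := fun _ _ _ _ _ => rfl
  have hS : IsPolyhedron (π1 ⁻¹' graphPiece a' c' J ∩ π2 ⁻¹' graphPiece a c I) :=
    ((isPolyhedron_graphPiece J).preimage π1).inter ((isPolyhedron_graphPiece I).preimage π2)
  obtain ⟨K, ε, hK, hε, H⟩ := hS.exists_hoffman B (0, 0, -b)
  simp only [hL, hL'] at hB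
  clear_value B
  refine ⟨3 * K, ε, by positivity, hε, fun x ρ u τ α hρ hτ w1 w2 w3 e1 e2 e3 hlt => ?_⟩
  have hres : B ((x, ρ), (u, τ), α) - (0, 0, -b) = (w1, w2, w3) := by
    rw [hB, e1, e2, Prod.mk_sub_mk, Prod.mk_sub_mk, sub_zero, sub_zero, ← e3]
    congr 2
    abel
  have hnorm : ‖B ((x, ρ), (u, τ), α) - (0, 0, -b)‖ ≤ ‖triple w1 w2 w3‖ := by
    obtain ⟨h1, h2, h3⟩ := norm_le_norm_triple w1 w2 w3
    rw [hres]
    exact max_le h1 (max_le h2 h3)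
  obtain ⟨⟨⟨x', ρ'⟩, ⟨u', τ'⟩, α'⟩, ⟨hρ', hτ'⟩, he', hd⟩ :=
    H ((x, ρ), (u, τ), α) ⟨hρ, hτ⟩ (hnorm.trans_lt hlt)
  rw [hB, Prod.mk.injEq, Prod.mk.injEq] at he'
  obtain ⟨q1, q2, q3⟩ := he'
  refine ⟨x', ρ', u', τ', α', hρ', hτ', q1, q2, ?_, ?_⟩
  · have : b - A x' - u' = b + (-A x' - u') := by abel
    rw [this, q3, add_neg_cancel]
  · have hd' : ‖((x, ρ), (u, τ), α) - ((x', ρ'), (u', τ'), α')‖ ≤ K * ‖triple w1 w2 w3‖ :=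
      hd.trans (by gcongr)
    have b1 : ‖x - x'‖ ≤ ‖((x, ρ), (u, τ), α) - ((x', ρ'), (u', τ'), α')‖ :=
      (le_max_left _ _).trans (le_max_left _ _)
    have b2 : ‖u - u'‖ ≤ ‖((x, ρ), (u, τ), α) - ((x', ρ'), (u', τ'), α')‖ :=
      (le_max_left _ _).trans ((le_max_left _ _).trans (le_max_right _ _))
    have b3 : ‖α - α'‖ ≤ ‖((x, ρ), (u, τ), α) - ((x', ρ'), (u', τ'), α')‖ :=
      (le_max_right _ _).trans (le_max_right _ _)
    rw [triple_sub]
    refine (norm_triple_le _ _ _).trans ?_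
    linarith

/-- Robinson's upper Lipschitz property of the polyhedral multifunction `T⁻¹` at the origin. The
graph of `T` is a finite union of polyhedra, indexed by sets of active affine functions of `‖·‖₁`
and `h`, and Hoffman's bound applies on each. As the nearby zero `(x', u', α')` lies in the same
piece as `(x, u, α)`, its multiplier `α'` removes all of the residual at `(x, u)` but `w3`. -/
lemma exists_upper_lipschitz (hp : IsPolyhedral h) :
    ∃ K ε : ℝ, 0 ≤ K ∧ 0 < ε ∧ ∀ (x w1 : Vec p) (u α w2 w3 : Vec n),
      triple w1 w2 w3 ∈ kkt h A b lam (triple x u α) → ‖triple w1 w2 w3‖ < ε →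
      ∃ x' u' α', 0 ∈ kkt h A b lam (triple x' u' α') ∧
        ‖triple x u α - triple x' u' α'‖ ≤ K * ‖triple w1 w2 w3‖ ∧
        triple 0 0 w3 ∈ kkt h A b lam (triple x u α') := by
  obtain ⟨m, a, c, hF⟩ := hp
  obtain ⟨m', a', c', hF'⟩ := isPolyhedral_l1 (d := p)
  choose K ε hK hε H using fun Q : Set (Fin (m' + 1)) × Set (Fin (m + 1)) =>
    exists_hoffman_graphPiece a c a' c' A b lam Q.1 Q.2
  obtain ⟨ε₀, hε₀, hlt⟩ : ∃ ε₀ > 0, ∀ Q, ε₀ < ε Q := by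
    have : ∀ᶠ t in 𝓝[>] (0 : ℝ), ∀ Q, t < ε Q := by
      rw [eventually_all]
      exact fun Q => nhdsWithin_le_nhds (gt_mem_nhds (hε Q))
    obtain ⟨t, h1, h2⟩ := (this.and self_mem_nhdsWithin).exists
    exact ⟨t, h2, h1⟩
  obtain ⟨K₀, hK₀⟩ := (Set.finite_range K).bddAbove
  have hK₀' : ∀ Q, K Q ≤ K₀ := fun Q => hK₀ (mem_range_self Q)
  refine ⟨K₀, ε₀, (hK (∅, ∅)).trans (hK₀' _), hε₀, ?_⟩
  intro x w1 u α w2 w3 hw hwlt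
  obtain ⟨⟨g, hg, e1⟩, hv, e3⟩ := mem_kkt_iff.1 hw
  obtain ⟨J, ρ, hρ, eρ⟩ := exists_weights_of_mem_subdiff hF' hg
  obtain ⟨I, τ, hτ, eτ⟩ := exists_weights_of_mem_subdiff hF hv
  obtain ⟨x', ρ', u', τ', α', hρ', hτ', q1, q2, q3, hd⟩ :=
    H (J, I) x ρ u τ α hρ hτ w1 w2 w3 (by rw [eρ, e1]) (by rw [eτ, add_sub_cancel_left]) e3
      (hwlt.trans (hlt _))
  have hα' : α' = ∑ i, τ' i • a i := (sub_eq_zero.1 q2).symm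
  have hmem : ∀ y ρ₁ z τ₁, (y, ρ₁) ∈ graphPiece a' c' J → (z, τ₁) ∈ graphPiece a c I →
      triple 0 0 (b - A y - z) ∈ kkt h A b lam (triple y z α') := by
    intro y ρ₁ z τ₁ hy hz
    have h1 : ∑ i, ρ' i • a' i ∈ subdiff l1 y := sum_smul_mem_subdiff hF' hy hρ'
    have h2 : ∑ i, τ' i • a i ∈ subdiff h z := sum_smul_mem_subdiff hF hz hτ'
    rw [← hα', ← add_zero α'] at h2
    exact mem_kkt_iff.2 ⟨⟨_, h1, q1⟩, h2, rfl⟩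
  refine ⟨x', u', α', ?_, hd.trans (by gcongr; exact hK₀' _), ?_⟩
  · have h1 := hmem x' ρ' u' τ' hρ' hτ'
    rw [q3] at h1
    exact h1
  · have h1 := hmem x ρ u τ hρ hτ
    rw [e3] at h1
    exact h1

lemma exists_isErrorBoundModulus (hh : ConvexOn ℝ univ h) (hlam : 0 < lam)
    (hp : IsPolyhedral h) : ∃ κ, IsErrorBoundModulus h A b lam κ := by
  obtain ⟨K, ε, hK, hε, H⟩ := exists_upper_lipschitz (A := A) (b := b) (lam := lam) hp
  refine ⟨K, hK, ε, hε, fun z hz => ?_⟩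
  obtain ⟨w, hw, e⟩ := exists_mem_kkt_norm_eq (A := A) (b := b) hh hlam z
  obtain ⟨x, u, α, rfl⟩ := exists_eq_triple z
  obtain ⟨w1, w2, w3, rfl⟩ := exists_eq_triple w
  rw [← e] at hz ⊢
  obtain ⟨x', u', α', h0, hd, -⟩ := H x w1 u α w2 w3 hw hz
  refine (Metric.infDist_le_dist_of_mem (y := triple x' u' α') h0).trans ?_
  rwa [dist_eq_norm]

end UpperLipschitz

/-! ### Existence of rank lasso solutions -/

lemma rankLoss_solutions_nonempty {n p : ℕ} (A : Vec p →L[ℝ] Vec n) (b : Vec n) {lam : ℝ}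
    (hlam : 0 < lam) : (solutions (rankLoss n) A b lam).Nonempty := by
  have hr : Continuous (rankLoss n) := by unfold rankLoss; fun_prop
  have hk := rankLoss_coeff_nonneg n
  have hcont : Continuous (objective (rankLoss n) A b lam) := by
    have := continuous_l1 (d := p)
    unfold objective
    fun_prop
  have hcoe : Tendsto (objective (rankLoss n) A b lam) (cocompact (Vec p)) atTop := by
    refine tendsto_atTop_mono (fun x => ?_)
      ((tendsto_norm_cocompact_atTop (E := Vec p)).const_mul_atTop hlam)
    have h1 : 0 ≤ rankLoss n (b - A x) := mul_nonneg hk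
      (Finset.sum_nonneg fun i _ => Finset.sum_nonneg fun j _ => abs_nonneg _)
    have h2 := mul_le_mul_of_nonneg_left (norm_le_l1 x) hlam.le
    unfold objective
    linarith
  obtain ⟨x, hx⟩ := hcont.exists_forall_le hcoe
  exact ⟨x, hx⟩

/-! ### Rates -/

section RateConstants

variable {κ : ℝ} {σ δ : ℕ → ℝ} {σinf : EReal}

lemma rateMu_nonneg (hκ : 0 ≤ κ) (s : ℝ) : 0 ≤ rateMu κ s := div_nonneg hκ (Real.sqrt_nonneg _)

lemma sqrt_sq_add_sq_pos {s : ℝ} (hs : 0 < s) : 0 < √(κ ^ 2 + s ^ 2) :=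
  Real.sqrt_pos.2 (by positivity)

lemma rateMu_lt_one {s : ℝ} (hs : 0 < s) : rateMu κ s < 1 := by
  rw [rateMu, div_lt_one (sqrt_sq_add_sq_pos hs)]
  exact Real.lt_sqrt_of_sq_lt (by nlinarith)

lemma tendsto_real_of_ne_top (hσ : ∀ k, 0 < σ k) (hmono : Monotone σ)
    (hlim : Tendsto (fun k => (σ k : EReal)) atTop (𝓝 σinf)) (htop : σinf ≠ ⊤) :
    0 < σinf.toReal ∧ Tendsto σ atTop (𝓝 σinf.toReal) := by
  have h0 : (σ 0 : EReal) ≤ σinf :=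
    ge_of_tendsto' hlim fun k => EReal.coe_le_coe_iff.2 (hmono (Nat.zero_le k))
  have hbot : σinf ≠ ⊥ := fun h => by simp [h] at h0
  rw [← EReal.coe_toReal htop hbot] at h0 hlim
  exact ⟨(hσ 0).trans_le (EReal.coe_le_coe_iff.1 h0), EReal.tendsto_coe.1 hlim⟩

lemma tendsto_rateMu (hκ : 0 ≤ κ) (hσ : ∀ k, 0 < σ k) (hmono : Monotone σ)
    (hlim : Tendsto (fun k => (σ k : EReal)) atTop (𝓝 σinf)) :
    Tendsto (fun k => rateMu κ (σ k)) atTop (𝓝 (rateMuInf κ σinf)) ∧ rateMuInf κ σinf < 1 := by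
  unfold rateMuInf
  split_ifs with htop
  · refine ⟨?_, one_pos⟩
    rw [htop] at hlim
    have hσ' : Tendsto σ atTop atTop := EReal.tendsto_coe_nhds_top_iff.1 hlim
    refine squeeze_zero (fun k => rateMu_nonneg hκ _) (fun k => ?_) (hσ'.const_div_atTop κ)
    refine div_le_div_of_nonneg_left hκ (hσ k) ?_
    exact Real.le_sqrt_of_sq_le (by nlinarith [sq_nonneg κ])
  · obtain ⟨hpos, hσ'⟩ := tendsto_real_of_ne_top hσ hmono hlim htop
    refine ⟨?_, rateMu_lt_one hpos⟩
    unfold rateMu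
    exact tendsto_const_nhds.div (((hσ'.pow 2).const_add _).sqrt) (sqrt_sq_add_sq_pos hpos).ne'

lemma tendsto_one_div_mul_zero (hσ : ∀ k, 0 < σ k) (hmono : Monotone σ) {a : ℕ → ℝ}
    (ha : ∀ k, 0 ≤ a k) (hlim : Tendsto a atTop (𝓝 0)) :
    Tendsto (fun k => 1 / σ k * a k) atTop (𝓝 0) := by
  refine squeeze_zero (fun k => by have := hσ k; have := ha k; positivity) (fun k => ?_)
    (by simpa using hlim.const_mul (1 / σ 0))
  have := ha k
  gcongr
  rw [one_div]
  exact inv_anti₀ (hσ 0) (hmono (Nat.zero_le _))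

lemma eventually_lt_of_summable (hδ : Summable δ) {t : ℝ} (ht : 0 < t) :
    ∀ᶠ k in atTop, δ k < t :=
  hδ.tendsto_atTop_zero.eventually_lt_const ht

lemma hasLinearRate_of_eventually {p : ℕ} {x : ℕ → Vec p} {xbar : Vec p} {c : ℝ} (hκ : 0 ≤ κ)
    (hσ : ∀ k, 0 < σ k) (hmono : Monotone σ)
    (hlim : Tendsto (fun k => (σ k : EReal)) atTop (𝓝 σinf)) (hδ : Summable δ)
    (h : ∀ᶠ k in atTop, ‖x (k + 1) - xbar‖ ≤ rateTheta κ c σ δ k * ‖x k - xbar‖) :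
    HasLinearRate κ c σ δ σinf x xbar := by
  obtain ⟨hμ, hlt⟩ := tendsto_rateMu hκ hσ hmono hlim
  have hδ0 := hδ.tendsto_atTop_zero
  have hθ : Tendsto (rateTheta κ c σ δ) atTop (𝓝 (rateMuInf κ σinf)) := by
    have := (hμ.add (hδ0.const_mul c)).div (hδ0.const_sub 1) (by norm_num)
    rw [mul_zero, add_zero, sub_zero, div_one] at this
    exact this
  exact ⟨hθ, eventually_atTop.1 ((hθ.eventually_lt_const hlt).and h)⟩

end RateConstants

/-- Geometric decay of the step bounds `d` controls the distance to the limit. -/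
lemma norm_sub_limit_le {p : ℕ} {x : ℕ → Vec p} {xbar : Vec p} (hx : Tendsto x atTop (𝓝 xbar))
    {d : ℕ → ℝ} {C : ℝ} (hC : 0 ≤ C) {K : ℕ} (h1 : ∀ k ≥ K, ‖x (k + 1) - x k‖ ≤ C * d k)
    (h2 : ∀ k ≥ K, d (k + 1) ≤ d k / 2) {k : ℕ} (hk : K ≤ k) :
    ‖x k - xbar‖ ≤ 2 * (C * d k) := by
  have hd : ∀ j, d (k + j) ≤ d k / 2 ^ j := by
    intro j
    induction j with
    | zero => simp
    | succ j ih =>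
      have := h2 (k + j) (by omega)
      rw [pow_succ, ← div_div]
      exact this.trans (by gcongr)
  have := dist_le_of_le_geometric_two_of_tendsto₀ (f := fun j => x (k + j)) (a := xbar)
    (C := 2 * (C * d k)) (fun j => by
      rw [dist_comm, dist_eq_norm]
      refine (h1 (k + j) (by omega)).trans ?_
      calc C * d (k + j) ≤ C * (d k / 2 ^ j) := by gcongr; exact hd j
        _ = 2 * (C * d k) / 2 / 2 ^ j := by ring)
    (hx.comp (tendsto_atTop_mono (fun j => Nat.le_add_left j k) tendsto_id))
  simpa [dist_eq_norm] using this

section Rates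

variable {p n : ℕ} {h : Vec n → ℝ} {A : Vec p →L[ℝ] Vec n} {b : Vec n} {lam κ : ℝ}
  {σ δ : ℕ → ℝ} {x : ℕ → Vec p} {xbar : Vec p}

lemma tendsto_step_zero (hx : Tendsto x atTop (𝓝 xbar)) :
    Tendsto (fun k => ‖x (k + 1) - x k‖) atTop (𝓝 0) := by
  have := ((hx.comp (tendsto_add_atTop_nat 1)).sub hx).norm
  simpa using this

lemma infDist_solutions_le (hlam : 0 < lam) (x : Vec p) (u α : Vec n)
    (hne : {z' | 0 ∈ kkt h A b lam z'}.Nonempty) :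
    Metric.infDist x (solutions h A b lam) ≤
      Metric.infDist (triple x u α) {z' | 0 ∈ kkt h A b lam z'} := by
  rw [Metric.le_infDist hne]
  intro z hz
  obtain ⟨x', u', α', rfl⟩ := exists_eq_triple z
  have hx' : x' ∈ solutions h A b lam := by
    rw [mem_ofPred_eq] at hz
    exact mem_solutions_of_zero_mem_kkt hlam hz
  refine (Metric.infDist_le_dist_of_mem hx').trans ?_
  rw [dist_eq_norm, dist_eq_norm, triple_sub]
  exact (norm_le_norm_triple _ _ _).1

lemma zeros_nonempty (hh : ConvexOn ℝ univ h) (hlam : 0 < lam) (hz : xbar ∈ solutions h A b lam) :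
    {z' | 0 ∈ kkt h A b lam z'}.Nonempty := by
  obtain ⟨α, hα⟩ := exists_zero_mem_kkt hh hlam hz
  exact ⟨_, hα⟩

lemma tendsto_prox_sub_zero (hx : Tendsto x atTop (𝓝 xbar)) (hδ : Summable δ) {y : ℕ → Vec p}
    (hy : ∀ k, ‖x (k + 1) - y k‖ ≤ δ k * ‖x (k + 1) - x k‖) :
    Tendsto (fun k => ‖x k - y k‖) atTop (𝓝 0) := by
  have hD := tendsto_step_zero hx
  refine squeeze_zero (fun _ => norm_nonneg _) (fun k => ?_)
    (g := fun k => ‖x (k + 1) - x k‖ + δ k * ‖x (k + 1) - x k‖) ?_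
  · have := norm_sub_le_norm_sub_add_norm_sub (x k) (x (k + 1)) (y k)
    rw [norm_sub_rev (x k) (x (k + 1))] at this
    linarith [hy k]
  · simpa using hD.add (hδ.tendsto_atTop_zero.mul hD)

/-- Rockafellar's rate for a unique solution. -/
lemma critB_rate_of_subsingleton (hh : ConvexOn ℝ univ h) (hlam : 0 < lam)
    (hσ : ∀ k, 0 < σ k) (hmono : Monotone σ) (hsol : xbar ∈ solutions h A b lam)
    (hsub : (solutions h A b lam).Subsingleton) (hκ : IsErrorBoundModulus h A b lam κ)
    (hx : Tendsto x atTop (𝓝 xbar)) (hB : CritB h A b lam σ δ x) :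
    ∀ᶠ k in atTop, ‖x (k + 1) - xbar‖ ≤ rateTheta κ 1 σ δ k * ‖x k - xbar‖ := by
  obtain ⟨hδ0, hδ, H⟩ := hB
  choose y hy hxy using H
  obtain ⟨hκ0, ε, hε, hmod⟩ := hκ
  have hQ := tendsto_prox_sub_zero hx hδ hxy
  have hc := tendsto_one_div_mul_zero hσ hmono (fun k => norm_nonneg (x k - y k)) hQ
  filter_upwards [hc.eventually_lt_const hε, eventually_lt_of_summable hδ one_pos] with k hk hδ1
  have hσk := hσ k
  obtain ⟨α, hα⟩ := proxPoint_exists_kkt hh hlam (hy k)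
  have h1 := infDist_zero_kkt_le hα
  rw [norm_triple_zero_zero, norm_smul, Real.norm_of_nonneg (by positivity)] at h1
  have h2 : ‖y k - xbar‖ ≤ κ * (1 / σ k * ‖x k - y k‖) := by
    have h3 := infDist_solutions_le (A := A) (b := b) hlam (y k) (b - A (y k)) α
      (zeros_nonempty hh hlam hsol)
    rw [hsub.eq_singleton_of_mem hsol, Metric.infDist_singleton, dist_eq_norm] at h3
    exact h3.trans ((hmod _ (h1.trans_lt hk)).trans (by gcongr))
  have h4 := proxPoint_fejer hh hlam hσk (hy k) hsol
  have h5 : ‖y k - xbar‖ ≤ rateMu κ (σ k) * ‖x k - xbar‖ := by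
    have hs := sqrt_sq_add_sq_pos (κ := κ) hσk
    rw [rateMu, div_mul_eq_mul_div, le_div_iff₀ hs]
    refine le_of_sq_le_sq ?_ (by positivity)
    rw [mul_pow, Real.sq_sqrt (by positivity)]
    have h6 : ‖y k - xbar‖ * σ k ≤ κ * ‖x k - y k‖ := by
      calc ‖y k - xbar‖ * σ k ≤ κ * (1 / σ k * ‖x k - y k‖) * σ k := by gcongr
        _ = κ * ‖x k - y k‖ := by field_simp
    have h7 : (‖y k - xbar‖ * σ k) ^ 2 ≤ (κ * ‖x k - y k‖) ^ 2 := by gcongr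
    have h8 := mul_le_mul_of_nonneg_left h4 (sq_nonneg κ)
    nlinarith
  have h6 := norm_sub_le_norm_sub_add_norm_sub (x (k + 1)) (y k) xbar
  have h7 := norm_sub_le_norm_sub_add_norm_sub (x (k + 1)) xbar (x k)
  rw [norm_sub_rev xbar] at h7
  have h8 := mul_le_mul_of_nonneg_left h7 (hδ0 k)
  rw [rateTheta, div_mul_eq_mul_div, le_div_iff₀ (by linarith)]
  nlinarith [hxy k]

/-- An error bound with modulus `0` forces the unique solution `0`: moving a solution along its own
ray keeps the subgradient of `‖·‖₁`, hence leaves only a residual `-s A x`, which must vanish. -/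
lemma subsingleton_of_isErrorBoundModulus_zero (hh : ConvexOn ℝ univ h) (hlam : 0 < lam)
    (hκ : IsErrorBoundModulus h A b lam 0) : (solutions h A b lam).Subsingleton := by
  obtain ⟨-, ε, hε, hmod⟩ := hκ
  suffices H : ∀ z ∈ solutions h A b lam, z = 0 from fun z hz z' hz' => by rw [H z hz, H z' hz']
  intro z hz
  obtain ⟨α, hα⟩ := exists_zero_mem_kkt hh hlam hz
  obtain ⟨⟨g, hg, e⟩, hαh, -⟩ := zero_mem_kkt_iff.1 hα
  set s : ℝ := ε / (2 * (‖A z‖ + 1)) with hs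
  have hs0 : 0 < s := by positivity
  have hsε : ‖s • A z‖ < ε := by
    rw [norm_smul, Real.norm_of_nonneg hs0.le, hs, div_mul_eq_mul_div, div_lt_iff₀ (by positivity)]
    nlinarith [norm_nonneg (A z)]
  have hmem : triple 0 0 (-(s • A z)) ∈ kkt h A b lam (triple ((1 + s) • z) (b - A z) α) := by
    refine mem_kkt_iff.2 ⟨⟨g, subdiff_l1_smul hg (by positivity), sub_eq_zero.2 e⟩,
      by rwa [add_zero], ?_⟩
    rw [map_smul, add_smul, one_smul]; abel
  have h1 := infDist_zero_kkt_le hmem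
  rw [norm_triple_zero_zero_right, norm_neg] at h1
  have h2 := hmod _ (h1.trans_lt hsε)
  rw [zero_mul] at h2
  have h3 : triple ((1 + s) • z) (b - A z) α ∈ closure {z' | 0 ∈ kkt h A b lam z'} :=
    (Metric.mem_closure_iff_infDist_zero (zeros_nonempty hh hlam hz)).2
      (le_antisymm h2 Metric.infDist_nonneg)
  have hcl : IsClosed {z' : Triple p n | z'.snd.fst = b - A z'.fst} :=
    isClosed_eq (by fun_prop) (by fun_prop)
  have hzeros : {z' | 0 ∈ kkt h A b lam z'} ⊆ {z' : Triple p n | z'.snd.fst = b - A z'.fst} := by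
    intro z' hz'
    obtain ⟨x', u', α', rfl⟩ := exists_eq_triple z'
    rw [mem_ofPred_eq] at hz' ⊢
    obtain ⟨-, -, hu⟩ := zero_mem_kkt_iff.1 hz'
    exact hu
  have h4 := closure_minimal hzeros hcl h3
  rw [mem_ofPred_eq] at h4
  have h5 : b - A z = b - A ((1 + s) • z) := h4
  have hAz : A z = 0 := by
    rw [map_smul, add_smul, one_smul, ← sub_sub, eq_comm, sub_eq_self] at h5
    exact (smul_eq_zero.1 h5).resolve_left hs0.ne'
  have h6 := hz 0
  simp only [objective, hAz, map_zero, l1_zero, mul_zero, add_zero] at h6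
  have h7 : l1 z ≤ 0 := by
    by_contra! h8
    have := mul_pos hlam h8
    linarith
  exact norm_le_zero_iff.1 ((norm_le_l1 z).trans h7)

/-- Finite termination of the exact algorithm in the polyhedral case: the proximal point is
eventually a solution. -/
lemma eventually_proxPoint_mem_solutions (hh : ConvexOn ℝ univ h) (hlam : 0 < lam)
    (hp : IsPolyhedral h) (hσ : ∀ k, 0 < σ k) (hmono : Monotone σ) {y : ℕ → Vec p}
    (hy : ∀ k, y k ∈ proxPoint h A b lam (σ k) (x k))
    (hQ : Tendsto (fun k => ‖x k - y k‖) atTop (𝓝 0)) :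
    ∀ᶠ k in atTop, y k ∈ solutions h A b lam := by
  obtain ⟨K, ε, hK, hε, H⟩ := exists_upper_lipschitz (A := A) (b := b) (lam := lam) hp
  have hc := tendsto_one_div_mul_zero hσ hmono (fun k => norm_nonneg (x k - y k)) hQ
  filter_upwards [hc.eventually_lt_const hε] with k hk
  have hσk := hσ k
  obtain ⟨α, hα⟩ := proxPoint_exists_kkt hh hlam (hy k)
  obtain ⟨-, -, α', -, -, h0⟩ := H _ _ _ _ _ _ hα (by
    rwa [norm_triple_zero_zero, norm_smul, Real.norm_of_nonneg (by positivity)])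
  rw [triple_zero] at h0
  exact mem_solutions_of_zero_mem_kkt hlam h0

/-- Under `(B)`, with `h` polyhedral, the convergence is superlinear. Eventually `y k` is the
projection of `x k` on the solution set, the distances `‖x k - y k‖` decrease superlinearly, and
the drift of the projections towards `xbar` is of smaller order than these distances. -/
lemma critB_superlinear (hh : ConvexOn ℝ univ h) (hlam : 0 < lam) (hp : IsPolyhedral h)
    (hσ : ∀ k, 0 < σ k) (hmono : Monotone σ) (hsol : xbar ∈ solutions h A b lam)
    (hx : Tendsto x atTop (𝓝 xbar)) (hB : CritB h A b lam σ δ x) {c : ℝ} (hc : 1 < c) :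
    ∀ᶠ k in atTop, ‖x (k + 1) - xbar‖ ≤ c * δ k / (1 - δ k) * ‖x k - xbar‖ := by
  obtain ⟨hδ0, hδ, H⟩ := hB
  choose y hy hxy using H
  have hQ := tendsto_prox_sub_zero hx hδ hxy
  have hev := eventually_proxPoint_mem_solutions hh hlam hp hσ hmono hy hQ
  obtain ⟨K, hK⟩ := eventually_atTop.1 ((hev.and (eventually_lt_of_summable hδ
    (show (0 : ℝ) < 1 / 4 by norm_num))).and (eventually_lt_of_summable hδ
    (show (0 : ℝ) < (c - 1) / 10 by linarith)))
  have hproj : ∀ k, ∀ z ∈ solutions h A b lam, ‖x k - y k‖ ≤ ‖x k - z‖ := fun k z hz =>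
    le_of_sq_le_sq (by nlinarith [proxPoint_fejer hh hlam (hσ k) (hy k) hz, sq_nonneg ‖y k - z‖])
      (norm_nonneg _)
  have hDk : ∀ k, (1 - δ k) * ‖x (k + 1) - x k‖ ≤ ‖x k - y k‖ := by
    intro k
    have := norm_sub_le_norm_sub_add_norm_sub (x (k + 1)) (y k) (x k)
    rw [norm_sub_rev (y k)] at this
    linarith [hxy k]
  have hD2 : ∀ k ≥ K, ‖x (k + 1) - x k‖ ≤ 2 * ‖x k - y k‖ := by
    intro k hk
    have := (hK k hk).1.2
    nlinarith [hDk k, norm_nonneg (x (k + 1) - x k)]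
  have hd1 : ∀ k ≥ K, ‖x (k + 1) - y (k + 1)‖ ≤ ‖x (k + 1) - y k‖ := fun k hk =>
    hproj _ _ (hK k hk).1.1
  have hhalf : ∀ k ≥ K, ‖x (k + 1) - y (k + 1)‖ ≤ ‖x k - y k‖ / 2 := by
    intro k hk
    have h1 := (hK k hk).1.2
    have h2 : δ k * ‖x (k + 1) - x k‖ ≤ 1 / 4 * (2 * ‖x k - y k‖) := by
      gcongr
      exact hD2 k hk
    linarith [hd1 k hk, hxy k]
  have hlimd : ∀ k ≥ K, ‖x k - xbar‖ ≤ 2 * (2 * ‖x k - y k‖) := fun k hk =>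
    norm_sub_limit_le (d := fun k => ‖x k - y k‖) hx two_pos.le hD2 hhalf hk
  refine eventually_atTop.2 ⟨K, fun k hk => ?_⟩
  have hk1 : K ≤ k + 1 := by omega
  have hδ1 := (hK k hk).1.2
  have h1 := norm_sub_le_norm_sub_add_norm_sub (x (k + 1)) (y (k + 1)) xbar
  have h2 := norm_sub_le_norm_sub_add_norm_sub (y (k + 1)) (x (k + 1 + 1)) xbar
  rw [norm_sub_rev (y (k + 1)) (x (k + 1 + 1))] at h2
  have h3 := hlimd (k + 1 + 1) (by omega)
  have h4 := hd1 (k + 1) hk1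
  have h5 := hxy (k + 1)
  have h6 : δ (k + 1) * ‖x (k + 1 + 1) - x (k + 1)‖ ≤
      (c - 1) / 10 * (2 * ‖x (k + 1) - y (k + 1)‖) :=
    mul_le_mul (hK (k + 1) hk1).2.le (hD2 (k + 1) hk1) (norm_nonneg _) (by linarith)
  have h7 : ‖x (k + 1) - xbar‖ ≤ c * ‖x (k + 1) - y (k + 1)‖ := by linarith
  have h8 : ‖x (k + 1) - y (k + 1)‖ ≤ δ k * ‖x (k + 1) - x k‖ := (hd1 k hk).trans (hxy k)
  have h9 : ‖x (k + 1) - x k‖ ≤ ‖x k - xbar‖ / (1 - δ k) := by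
    rw [le_div_iff₀ (by linarith), mul_comm]
    exact (hDk k).trans (hproj k _ hsol)
  have := hδ0 k
  calc ‖x (k + 1) - xbar‖ ≤ c * ‖x (k + 1) - y (k + 1)‖ := h7
    _ ≤ c * (δ k * ‖x (k + 1) - x k‖) := by gcongr
    _ ≤ c * (δ k * (‖x k - xbar‖ / (1 - δ k))) := by gcongr
    _ = c * δ k / (1 - δ k) * ‖x k - xbar‖ := by ring

/-- The form in which `8 δ k κ / σ k` is absorbed into `μ_k` for small `δ k`. -/
lemma mul_div_le_rateMu (hκ : 0 ≤ κ) {s s₀ t : ℝ} (hs₀ : 0 < s₀) (hs : s₀ ≤ s)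
    (ht : 0 ≤ t) (htκ : 8 * t * (κ / s₀ + 1) ≤ 1) : 8 * t * (κ / s) ≤ rateMu κ s := by
  have hs' : 0 < s := hs₀.trans_le hs
  have hsq : √(κ ^ 2 + s ^ 2) ≤ κ + s :=
    Real.sqrt_le_iff.2 ⟨by positivity, by nlinarith [mul_nonneg hκ hs'.le]⟩
  have h4 : κ + s ≤ s * (κ / s₀ + 1) := by
    have h5 : s * (κ / s) ≤ s * (κ / s₀) := by gcongr
    have h6 : s * (κ / s) = κ := by field_simp
    linarith
  rw [rateMu, le_div_iff₀ (sqrt_sq_add_sq_pos hs')]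
  calc 8 * t * (κ / s) * √(κ ^ 2 + s ^ 2)
      ≤ 8 * t * (κ / s) * (s * (κ / s₀ + 1)) := by gcongr; exact hsq.trans h4
    _ = κ * (8 * t * (κ / s₀ + 1)) := by field_simp
    _ ≤ κ * 1 := by gcongr
    _ = κ := mul_one κ

/-- One step under `(B')`, with `h` polyhedral. Replacing the multiplier leaves only the residual
`w3`, so the distance to the solution set after the step is at most `κ δ k / σ k` times the step.
The length of the step is bounded by the monotonicity of the subdifferentials. -/
lemma critB'_step (hh : ConvexOn ℝ univ h) (hlam : 0 < lam) (hp : IsPolyhedral h)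
    (hσ : ∀ k, 0 < σ k) (hmono : Monotone σ) (hsol : xbar ∈ solutions h A b lam)
    (hκ : IsErrorBoundModulus h A b lam κ)
    (hx : Tendsto x atTop (𝓝 xbar)) (hB : CritB' h A b lam σ δ x) :
    ∀ᶠ k in atTop,
      Metric.infDist (x (k + 1)) (solutions h A b lam) ≤ κ * (δ k / σ k * ‖x (k + 1) - x k‖) ∧
      ∀ z ∈ solutions h A b lam, ‖x (k + 1) - x k‖ ≤ 2 * ‖x k - z‖ := by
  obtain ⟨hδ0, hδ, u, α, H⟩ := hB
  choose w1 w2 w3 hw1 hw2 hw3 hw using fun k =>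
    exists_residual hh hlam (σ k) (x k) (x (k + 1)) (u (k + 1)) (α (k + 1)) (H k)
  obtain ⟨hκ0, ε, hε, hmod⟩ := hκ
  obtain ⟨L, ε₀, hL, hε₀, hlip⟩ := exists_upper_lipschitz (A := A) (b := b) (lam := lam) hp
  have hσ0 : ∀ k, σ 0 ≤ σ k := fun k => hmono (Nat.zero_le k)
  have hs0 := hσ 0
  set D : ℕ → ℝ := fun k => ‖x (k + 1) - x k‖ with hD
  have hDnn : ∀ k, 0 ≤ D k := fun k => norm_nonneg _
  have hD0 : Tendsto D atTop (𝓝 0) := tendsto_step_zero hx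
  have hne := zeros_nonempty (A := A) (b := b) hh hlam hsol
  -- The norm of the residual of `T` at the iterate is at most `4 D k / σ k` once `δ k ≤ 1`.
  have hres : ∀ k, δ k ≤ 1 →
      ‖triple (w1 k - (1 / σ k) • (x (k + 1) - x k)) (w2 k) (w3 k)‖ ≤ 4 * (D k / σ k) := by
    intro k hk
    have hσk := hσ k
    have h1 : δ k / σ k * D k ≤ D k / σ k := by
      rw [div_mul_eq_mul_div]
      gcongr
      nlinarith [hDnn k]
    have h2 : ‖w1 k - (1 / σ k) • (x (k + 1) - x k)‖ ≤ ‖w1 k‖ + D k / σ k := by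
      refine (norm_sub_le _ _).trans ?_
      rw [norm_smul, Real.norm_of_nonneg (by positivity), one_div_mul_eq_div]
    have h3 := norm_triple_le (w1 k - (1 / σ k) • (x (k + 1) - x k)) (w2 k) (w3 k)
    linarith [hw1 k, hw2 k, hw3 k]
  have hDσ : Tendsto (fun k => 4 * (D k / σ k)) atTop (𝓝 0) := by
    refine squeeze_zero (fun k => by have := hDnn k; have := hσ k; positivity) (fun k => ?_)
      (g := fun k => 4 * (D k / σ 0)) (by simpa using (hD0.div_const (σ 0)).const_mul 4)
    have := hDnn k
    have := hσ0 k
    gcongr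
  set C : ℝ := (1 + ‖A‖) + (1 + 4 * L) / σ 0 with hC
  have hC0 : 0 < C := by positivity
  filter_upwards [hDσ.eventually_lt_const hε₀, hDσ.eventually_lt_const hε,
    eventually_lt_of_summable hδ one_pos,
    eventually_lt_of_summable hδ (show 0 < 1 / (4 * C) by positivity)] with k h1 h2 h3 h4
  have hσk := hσ k
  have hδk := hδ0 k
  have hDk := hDnn k
  obtain ⟨x', u', β, hzero, hdist, hβ⟩ := hlip _ _ _ _ _ _ (hw k) ((hres k h3.le).trans_lt h1)
  have h5 := infDist_zero_kkt_le hβ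
  rw [norm_triple_zero_zero_right] at h5
  have h6 : ‖w3 k‖ ≤ δ k / σ k * D k := hw3 k
  have h7 : δ k / σ k * D k ≤ D k / σ k := by
    rw [div_mul_eq_mul_div]
    gcongr
    nlinarith
  have h8 : 0 ≤ D k / σ k := by positivity
  constructor
  · refine (infDist_solutions_le hlam _ _ _ hne).trans ((hmod _ (by linarith)).trans ?_)
    gcongr
    linarith
  intro z hz
  have hz' := zero_mem_kkt_of_mem_solutions hlam hz hzero
  obtain ⟨⟨g', hg', e'⟩, hβz, -⟩ := zero_mem_kkt_iff.1 hz'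
  obtain ⟨⟨g, hg, e⟩, hv, e3⟩ := mem_kkt_iff.1 (hw k)
  have m1 := subdiff_monotone hv hβz
  have m2 := mul_nonneg hlam.le (subdiff_monotone hg hg')
  have h9 : u (k + 1) - (b - A z) = -(A (x (k + 1) - z)) - w3 k := by
    rw [map_sub, ← e3]; abel
  -- The sum of the monotonicity inequalities of the two subdifferentials.
  have h10 : ⟪x (k + 1) - x k, x (k + 1) - z⟫ ≤
      σ k * (⟪w1 k - ContinuousLinearMap.adjoint A (w2 k), x (k + 1) - z⟫ -
        ⟪α (k + 1) + w2 k - β, w3 k⟫) := by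
    have h11 : lam * ⟪g - g', x (k + 1) - z⟫ =
        ⟪w1 k - (1 / σ k) • (x (k + 1) - x k), x (k + 1) - z⟫ +
          ⟪α (k + 1) - β, A (x (k + 1) - z)⟫ := by
      have h12 : lam • (g - g') = w1 k - (1 / σ k) • (x (k + 1) - x k) +
          ContinuousLinearMap.adjoint A (α (k + 1) - β) := by
        rw [smul_sub, e', ← e, map_sub]; abel
      have h13 := congrArg (fun q => ⟪q, x (k + 1) - z⟫) h12
      simp only [inner_smul_left, conj_trivial] at h13
      rw [h13, inner_add_left, ContinuousLinearMap.adjoint_inner_left]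
    rw [h11, inner_sub_left, inner_smul_left] at m2
    rw [h9, inner_sub_right, inner_neg_right] at m1
    simp only [conj_trivial] at m2
    have h14 : ⟪α (k + 1) + w2 k - β, A (x (k + 1) - z)⟫ =
        ⟪α (k + 1) - β, A (x (k + 1) - z)⟫ + ⟪w2 k, A (x (k + 1) - z)⟫ := by
      rw [← inner_add_left]; congr 1; abel
    rw [inner_sub_left (w1 k), ContinuousLinearMap.adjoint_inner_left]
    have h15 : 1 / σ k * ⟪x (k + 1) - x k, x (k + 1) - z⟫ ≤
        ⟪w1 k, x (k + 1) - z⟫ - ⟪w2 k, A (x (k + 1) - z)⟫ - ⟪α (k + 1) + w2 k - β, w3 k⟫ := by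
      linarith
    rwa [one_div, inv_mul_le_iff₀ hσk] at h15
  have h11 : ⟪w1 k - ContinuousLinearMap.adjoint A (w2 k), x (k + 1) - z⟫ ≤
      (1 + ‖A‖) * (δ k / σ k * D k) * ‖x (k + 1) - z‖ :=
    (real_inner_le_norm _ _).trans (by gcongr; exact norm_sub_adjoint_le (hw1 k) (hw2 k))
  have h12 : ‖α (k + 1) + w2 k - β‖ ≤ (1 + 4 * L) * (D k / σ k) := by
    have h13 : ‖α (k + 1) - β‖ ≤ L * (4 * (D k / σ k)) := by
      rw [triple_sub] at hdist
      refine (norm_le_norm_triple _ _ _).2.2.trans (hdist.trans ?_)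
      gcongr
      exact hres k h3.le
    have h14 : α (k + 1) + w2 k - β = (α (k + 1) - β) + w2 k := by abel
    rw [h14]
    refine (norm_add_le _ _).trans ?_
    linarith [hw2 k]
  have h13 : -⟪α (k + 1) + w2 k - β, w3 k⟫ ≤ (1 + 4 * L) * (D k / σ k) * (δ k / σ k * D k) :=
    (neg_le_abs _).trans ((abs_real_inner_le_norm _ _).trans (by gcongr))
  have h14 : D k / σ k ≤ D k / σ 0 := by gcongr; exact hσ0 k
  have h15 : ⟪x (k + 1) - x k, x (k + 1) - z⟫ ≤ C * (δ k * D k) * (‖x (k + 1) - z‖ + D k) := by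
    have h16 : σ k * ((1 + ‖A‖) * (δ k / σ k * D k) * ‖x (k + 1) - z‖ +
        (1 + 4 * L) * (D k / σ k) * (δ k / σ k * D k)) =
        (1 + ‖A‖) * (δ k * D k) * ‖x (k + 1) - z‖ + (1 + 4 * L) * (D k / σ k) * (δ k * D k) := by
      field_simp
    have h17 : (1 + 4 * L) * (D k / σ k) * (δ k * D k) ≤
        (1 + 4 * L) * (D k / σ 0) * (δ k * D k) := by gcongr
    have h18 : C * (δ k * D k) * (‖x (k + 1) - z‖ + D k) =
        ((1 + ‖A‖) * (δ k * D k) * ‖x (k + 1) - z‖ + (1 + 4 * L) * (D k / σ 0) * (δ k * D k)) +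
        ((1 + ‖A‖) * (δ k * D k) * D k + (1 + 4 * L) / σ 0 * (δ k * D k) * ‖x (k + 1) - z‖) := by
      rw [hC]; ring
    have h19 : 0 ≤ (1 + ‖A‖) * (δ k * D k) * D k +
        (1 + 4 * L) / σ 0 * (δ k * D k) * ‖x (k + 1) - z‖ := by positivity
    have h20 := h10.trans (mul_le_mul_of_nonneg_left
      (show _ ≤ (1 + ‖A‖) * (δ k / σ k * D k) * ‖x (k + 1) - z‖ +
        (1 + 4 * L) * (D k / σ k) * (δ k / σ k * D k) by linarith) hσk.le)
    linarith
  have h16 : C * δ k ≤ 1 / 4 := by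
    rw [lt_div_iff₀ (by positivity)] at h4
    linarith
  have h17 : C * (δ k * D k) * (‖x (k + 1) - z‖ + D k) ≤
      1 / 4 * (D k * (‖x (k + 1) - z‖ + D k)) := by
    have := mul_le_mul_of_nonneg_right h16
      (show 0 ≤ D k * (‖x (k + 1) - z‖ + D k) by positivity)
    linarith
  have h18 : ‖x k - z‖ ^ 2 = ‖x (k + 1) - z‖ ^ 2 - 2 * ⟪x (k + 1) - x k, x (k + 1) - z⟫ +
      D k ^ 2 := by
    have : x k - z = (x (k + 1) - z) - (x (k + 1) - x k) := by abel
    rw [this, norm_sub_sq_real, real_inner_comm]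
  refine le_of_sq_le_sq ?_ (by positivity)
  nlinarith [sq_nonneg (‖x (k + 1) - z‖ - D k), sq_nonneg ‖x (k + 1) - z‖]
/-- Under `(B')`, with `h` polyhedral, the distances to the solution set decrease superlinearly, and
so fast that `δ k → 0` absorbs all constants into `μ_k`. -/
lemma critB'_rate (hh : ConvexOn ℝ univ h) (hlam : 0 < lam) (hp : IsPolyhedral h)
    (hσ : ∀ k, 0 < σ k) (hmono : Monotone σ) (hsol : xbar ∈ solutions h A b lam)
    (hκ : IsErrorBoundModulus h A b lam κ)
    (hx : Tendsto x atTop (𝓝 xbar)) (hB : CritB' h A b lam σ δ x) :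
    ∀ᶠ k in atTop, ‖x (k + 1) - xbar‖ ≤ rateMu κ (σ k) * ‖x k - xbar‖ := by
  have hstep := critB'_step hh hlam hp hσ hmono hsol hκ hx hB
  have hδ0 := hB.1
  have hδ := hB.2.1
  have hσ0 : ∀ k, σ 0 ≤ σ k := fun k => hmono (Nat.zero_le k)
  have hs0 := hσ 0
  have hκ0 := hκ.1
  set D : ℕ → ℝ := fun k => ‖x (k + 1) - x k‖ with hD
  have hκσ : ∀ k, κ / σ k ≤ κ / σ 0 := fun k =>
    div_le_div_of_nonneg_left hκ0 hs0 (hσ0 k)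
  obtain ⟨K, hK⟩ := eventually_atTop.1 (hstep.and (eventually_lt_of_summable hδ
    (show 0 < 1 / (8 * (κ / σ 0 + 1)) by positivity)))
  set d : ℕ → ℝ := fun k => Metric.infDist (x k) (solutions h A b lam) with hd
  have hsolne : (solutions h A b lam).Nonempty := ⟨xbar, hsol⟩
  have hDd : ∀ k ≥ K, D k ≤ 2 * d k := by
    intro k hk
    have : D k / 2 ≤ d k := by
      rw [hd, Metric.le_infDist hsolne]
      intro z hz
      rw [dist_eq_norm]
      linarith [(hK k hk).1.2 z hz]
    linarith
  have hδκ : ∀ k ≥ K, 8 * δ k * (κ / σ 0 + 1) ≤ 1 := by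
    intro k hk
    have := (hK k hk).2
    rw [lt_div_iff₀ (by positivity)] at this
    linarith
  have hd1 : ∀ k ≥ K, d (k + 1) ≤ δ k * (κ / σ k) * D k := fun k hk =>
    ((hK k hk).1.1).trans (le_of_eq (by ring))
  have hhalf : ∀ k ≥ K, d (k + 1) ≤ d k / 2 := by
    intro k hk
    have h1 := hδ0 k
    have h2 : δ k * (κ / σ k) ≤ 1 / 8 := by
      have : δ k * (κ / σ k) ≤ δ k * (κ / σ 0 + 1) := by
        gcongr
        linarith [hκσ k]
      linarith [hδκ k hk]
    have h3 : δ k * (κ / σ k) * D k ≤ 1 / 8 * (2 * d k) := by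
      gcongr
      exact hDd k hk
    have h4 : 0 ≤ d k := Metric.infDist_nonneg
    linarith [hd1 k hk]
  refine eventually_atTop.2 ⟨K, fun k hk => ?_⟩
  have h1 : ‖x (k + 1) - xbar‖ ≤ 2 * (2 * d (k + 1)) :=
    norm_sub_limit_le hx two_pos.le hDd hhalf (by omega)
  have h2 : D k ≤ 2 * ‖x k - xbar‖ := (hK k hk).1.2 _ hsol
  have hδk := hδ0 k
  have hσk := hσ k
  have h3 := mul_div_le_rateMu hκ.1 hs0 (hσ0 k) hδk (hδκ k hk)
  have h5 : δ k * (κ / σ k) * D k ≤ δ k * (κ / σ k) * (2 * ‖x k - xbar‖) := by gcongr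
  have h6 := mul_le_mul_of_nonneg_right h3 (norm_nonneg (x k - xbar))
  linarith [hd1 k hk]

end Rates
end HdrLasso

theorem mainTheorem2 (n p : ℕ) (A : HdrLasso.Vec p →L[ℝ] HdrLasso.Vec n) (b : HdrLasso.Vec n)
    (lam : ℝ) (hlam : 0 < lam) :
    (∀ h : HdrLasso.Vec n → ℝ, ConvexOn ℝ Set.univ h →
      (HdrLasso.solutions h A b lam).Nonempty →
      ∀ (σ : ℕ → ℝ) (σinf : EReal), (∀ k, 0 < σ k) → Monotone σ →
      Tendsto (fun k => (σ k : EReal)) atTop (𝓝 σinf) →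
      ∀ x : ℕ → HdrLasso.Vec p,
      (HdrLasso.CritA h A b lam σ x ∨ HdrLasso.CritA' h A b lam σ x) →
      ∃ xbar ∈ HdrLasso.solutions h A b lam, Tendsto x atTop (𝓝 xbar) ∧
        (HdrLasso.IsPolyhedral h →
          (∃ κ, HdrLasso.IsErrorBoundModulus h A b lam κ) ∧
          ∀ κ, HdrLasso.IsErrorBoundModulus h A b lam κ → ∀ δ : ℕ → ℝ,
            (HdrLasso.CritB' h A b lam σ δ x → HdrLasso.HasLinearRate κ 1 σ δ σinf x xbar) ∧
            (HdrLasso.CritB h A b lam σ δ x → σinf ≠ ⊤ →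
              HdrLasso.HasLinearRate κ 1 σ δ σinf x xbar) ∧
            (HdrLasso.CritB h A b lam σ δ x → ∀ c > 1,
              HdrLasso.HasLinearRate κ c σ δ σinf x xbar)) ∧
        ((HdrLasso.solutions h A b lam).Subsingleton →
          ∀ κ, HdrLasso.IsErrorBoundModulus h A b lam κ → ∀ δ : ℕ → ℝ,
            HdrLasso.CritB h A b lam σ δ x → HdrLasso.HasLinearRate κ 1 σ δ σinf x xbar)) ∧
    (HdrLasso.IsPolyhedral (HdrLasso.rankLoss n) ∧
      (HdrLasso.solutions (HdrLasso.rankLoss n) A b lam).Nonempty) := by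
  open HdrLasso in
  refine ⟨?_, isPolyhedral_rankLoss n, rankLoss_solutions_nonempty A b hlam⟩
  intro h hh hsol σ σinf hσ hmono hlim x hA
  obtain ⟨xbar, hxbar, hx⟩ : ∃ z ∈ solutions h A b lam, Tendsto x atTop (𝓝 z) := by
    rcases hA with hA | hA
    · exact critA_converges hh hlam hsol hσ hmono hA
    · exact critA'_converges hh hlam hsol hσ hmono hA
  have hunique : (solutions h A b lam).Subsingleton →
      ∀ κ, IsErrorBoundModulus h A b lam κ → ∀ δ : ℕ → ℝ,
        CritB h A b lam σ δ x → HasLinearRate κ 1 σ δ σinf x xbar := fun hsub κ hκ δ hB =>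
    hasLinearRate_of_eventually hκ.1 hσ hmono hlim hB.2.1
      (critB_rate_of_subsingleton hh hlam hσ hmono hxbar hsub hκ hx hB)
  refine ⟨xbar, hxbar, hx, fun hp => ⟨exists_isErrorBoundModulus hh hlam hp,
    fun κ hκ δ => ⟨fun hB => ?_, fun hB htop => ?_, fun hB c hc => ?_⟩⟩, hunique⟩
  · refine hasLinearRate_of_eventually hκ.1 hσ hmono hlim hB.2.1 ?_
    filter_upwards [critB'_rate hh hlam hp hσ hmono hxbar hκ hx hB,
      eventually_lt_of_summable hB.2.1 one_pos] with k hk hδ1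
    refine hk.trans (mul_le_mul_of_nonneg_right ?_ (norm_nonneg _))
    have h0 := hB.1 k
    have h1 := rateMu_nonneg hκ.1 (σ k)
    rw [rateTheta, le_div_iff₀ (by linarith)]
    nlinarith
  · rcases hκ.1.eq_or_lt with rfl | hpos
    · exact hunique (subsingleton_of_isErrorBoundModulus_zero hh hlam hκ) 0 hκ δ hB
    -- As `μ_k` is bounded away from `0`, it dominates the second `δ k` of the constant `c = 2`.
    refine hasLinearRate_of_eventually hκ.1 hσ hmono hlim hB.2.1 ?_
    have hμ : 0 < rateMuInf κ σinf := by
      rw [rateMuInf, if_neg htop]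
      exact div_pos hpos (sqrt_sq_add_sq_pos (tendsto_real_of_ne_top hσ hmono hlim htop).1)
    have hev := (tendsto_rateMu hκ.1 hσ hmono hlim).1.eventually_const_lt (half_lt_self hμ)
    filter_upwards [critB_superlinear hh hlam hp hσ hmono hxbar hx hB one_lt_two, hev,
      eventually_lt_of_summable hB.2.1 one_pos,
      eventually_lt_of_summable hB.2.1 (half_pos hμ)] with k hk h1 h2 h3
    refine hk.trans (mul_le_mul_of_nonneg_right ?_ (norm_nonneg _))
    exact div_le_div_of_nonneg_right (by linarith) (by linarith)
  · refine hasLinearRate_of_eventually hκ.1 hσ hmono hlim hB.2.1 ?_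
    filter_upwards [critB_superlinear hh hlam hp hσ hmono hxbar hx hB hc,
      eventually_lt_of_summable hB.2.1 one_pos] with k hk h1
    refine hk.trans (mul_le_mul_of_nonneg_right ?_ (norm_nonneg _))
    exact div_le_div_of_nonneg_right (by linarith [rateMu_nonneg hκ.1 (σ k)]) (by linarith)
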